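/- **Setting.** Let $F$ be an isotropic probability distribution on $\mathbb R^n$ (mean $0$, covariance $I_n$) with finite absolute moments up to order $m$, let $V\subseteq\mathbb R^n$ be a subspace of dimension $k$ and $W=V^\perp$, and suppose $F=F_VF_W$, i.e. for $x\sim F$ the projections $\pi_V(x)$ and $\pi_W(x)$ are independent, with $F_W$ the standard Gaussian distribution on $W$. Let $\gamma_r$ be the $r$-th moment of a standard Gaussian real variable, $f_r(u)=\mathbb E_F[(x^Tu)^r]$ and $g_r(u)=f_r(u)-\gamma_r\|u\|^r$. For $3\le r\le m$ let $M_r>0$ be an upper bound for $|f_r|$ on the unit sphere. **LocalOpt.** Let $g$ be a homogeneous function of degree $r$ on a Euclidean space. From a unit vector $u$, with parameter $\epsilon_1$ and step sizes $\rho_1,\rho_2$, repeat: if $|\langle u,Dg_u\rangle|\le(1-\epsilon_1)\|Dg_u\|$, let $v=\pi_{u^\perp}(Dg_u)$ and replace $u$ by $u+\rho_1v/\|v\|$, rescaled to norm $1$; otherwise, if $\lambda_{\max}(D^2g_u)\ge\frac34r(r-1)g(u)$ on $u^\perp$, let $v$ be a unit top eigenvector of $D^2g_u$ on $u^\perp$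 (either sign) and replace $u$ by $u-\rho_2v$, rescaled to norm $1$; otherwise halt and return $u$. **FindBasis.** Start with the empty list $B$ and $r=2$. While $|B|<n$ and $r\le m$: if $f_r\equiv\gamma_r$ on the unit sphere of $B^\perp$, increase $r$ by $1$; otherwise take a sign $\sigma\in\{1,-1\}$ and a unit vector $v\in B^\perp$ with $\sigma g_r(v)\ge\eta_r$, run LocalOpt on $\sigma g_r$ restricted to $B^\perp$ from $v$ with parameter $\epsilon_1$ and step sizes $\rho_{1,r},\rho_{2,r}$, and append the returned vector to $B$. Here, for $3\le r\le m$, $\eta_r>0$, $$0<\rho_{1,r}\le\frac{\sqrt{\epsilon_1}\,\eta_r}{4r^2M_r},\qquad 8\sqrt{\epsilon_1}\le\rho_{2,r}\le\frac{9\eta_r}{256(r-2)M_r}.$$ **Theorem (Multiple iterations).** For every $k$ there is $\epsilon_0>0$, depending only on $k$, such that the following holds in every such setting and for every $0<\epsilon_1\le\epsilon_0$. Suppose that an execution of FindBasis has found $j$ vectors $u_1,\dots,u_j$ (in this order), $1\le j\le k$, and that $\eta_r\ge M_r\,\epsilon_1^{(1/16)^j}$ for $3\le r\le m$. Then $$\|\pi_V(u_j)\|^2\ge1-\epsilon_1^{(1/16)^j},$$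 and hence $\|\pi_V(u_j)\|^2\ge 1-\epsilon_1^{(1/16)^k}$, so the error grows at most doubly exponentially in $k$. -/

import Mathlib

open MeasureTheory ProbabilityTheory
open scoped Gradient

noncomputable section

/-- The `r`-th moment `γ_r` of a standard Gaussian real random variable. -/
def gaussMoment (r : ℕ) : ℝ := ∫ t, t ^ r ∂(gaussianReal 0 1)

/-- The `r`-th directional moment `f_r(u) = E_F[⟨x, u⟩ ^ r]`. -/
def dirMoment {n : ℕ} (F : Measure (EuclideanSpace ℝ (Fin n))) (r : ℕ)
    (u : EuclideanSpace ℝ (Fin n)) : ℝ :=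
  ∫ x, (inner ℝ x u) ^ r ∂F

/-- The function `g_r(u) = f_r(u) - γ_r ‖u‖ ^ r` optimised by the local search. -/
def excess {n : ℕ} (F : Measure (EuclideanSpace ℝ (Fin n))) (r : ℕ)
    (u : EuclideanSpace ℝ (Fin n)) : ℝ :=
  dirMoment F r u - gaussMoment r * ‖u‖ ^ r

/-- `F = F_V F_W` with `W = Vᗮ`: the coordinates in `V` and in `W` are independent, and
`F_W` is the standard Gaussian distribution on `W`. -/
structure FactorsWithGaussianNoise {n : ℕ} (F : Measure (EuclideanSpace ℝ (Fin n)))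
    (V : Submodule ℝ (EuclideanSpace ℝ (Fin n))) : Prop where
  indep : IndepFun (fun x => V.orthogonalProjectionOnto x)
    (fun x => Vᗮ.orthogonalProjectionOnto x) F
  gaussian : F.map (fun x => Vᗮ.orthogonalProjectionOnto x) = stdGaussian Vᗮ

/-- `F` has mean zero and identity covariance. -/
structure IsIsotropic {n : ℕ} (F : Measure (EuclideanSpace ℝ (Fin n))) : Prop where
  mean : ∀ u, dirMoment F 1 u = 0
  cov : ∀ u, dirMoment F 2 u = ‖u‖ ^ 2

/-! ### The local search -/

section LocalSearch

variable {E : Type*} [NormedAddCommGroup E] [InnerProductSpace ℝ E] [CompleteSpace E]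

/-- The quadratic form `vᵀ (D²g_u) v` of the Hessian. -/
def hessForm (g : E → ℝ) (u v : E) : ℝ := fderiv ℝ (fderiv ℝ g) u v v

/-- `v` is a unit top eigenvector of `D²g_u` on the subspace `u^⊥`; the top eigenvalue of
`D²g_u` on `u^⊥` is then `hessForm g u v`. -/
structure IsTopEigenvector (g : E → ℝ) (u v : E) : Prop where
  norm_eq : ‖v‖ = 1
  orth : inner ℝ u v = 0
  max : ∀ w : E, ‖w‖ = 1 → inner ℝ u w = 0 → hessForm g u w ≤ hessForm g u v

/-- First loop condition: `|⟨u, Dg_u⟩| ≤ (1 - ε₁) ‖Dg_u‖`. -/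
def GradientCond (ε₁ : ℝ) (g : E → ℝ) (u : E) : Prop :=
  |inner ℝ u (∇ g u)| ≤ (1 - ε₁) * ‖∇ g u‖

/-- The threshold `ε₂ = 3 r (r - 1) g(u) / 4` of the second order test, for `g` homogeneous of
degree `r`. -/
def hessThreshold (r : ℕ) (g : E → ℝ) (u : E) : ℝ := 3 * r * (r - 1) * g u / 4

/-- Second loop condition: `λ_max(D²g_u) ≥ ε₂` on `u^⊥`. -/
def HessianCond (r : ℕ) (g : E → ℝ) (u : E) : Prop :=
  ∃ v, IsTopEigenvector g u v ∧ hessThreshold r g u ≤ hessForm g u v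

/-- The component of the gradient orthogonal to the unit vector `u`. -/
def tangentGradient (g : E → ℝ) (u : E) : E := ∇ g u - (inner ℝ u (∇ g u)) • u

/-- Rescaling to norm one. -/
def renormalize (u : E) : E := ‖u‖⁻¹ • u

/-- One pass through the loop of the local search, with step sizes `r₁` and `r₂`. A top
eigenvector is determined up to sign at best; every choice is allowed. -/
inductive LocalOptStep (ε₁ r₁ r₂ : ℝ) (r : ℕ) (g : E → ℝ) : E → E → Prop
  | first (u : E) (h : GradientCond ε₁ g u) :
      LocalOptStep ε₁ r₁ r₂ r g u
        (renormalize (u + (r₁ / ‖tangentGradient g u‖) • tangentGradient g u))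
  | second (u v : E) (h : ¬ GradientCond ε₁ g u) (hv : IsTopEigenvector g u v)
      (h₂ : hessThreshold r g u ≤ hessForm g u v) :
      LocalOptStep ε₁ r₁ r₂ r g u (renormalize (u - r₂ • v))

/-- The local search started at `u₀` halts and returns `u`. -/
structure LocalOptReturns (ε₁ r₁ r₂ : ℝ) (r : ℕ) (g : E → ℝ) (u₀ u : E) : Prop where
  run : Relation.ReflTransGen (LocalOptStep ε₁ r₁ r₂ r g) u₀ u
  halt₁ : ¬ GradientCond ε₁ g u
  halt₂ : ¬ HessianCond r g u

end LocalSearch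

/-- Admissible parameters for the search on the moment of order `r`, where `M` bounds the `r`-th
moments, `η` is the required starting value and `r₁`, `r₂` are the step sizes. -/
structure AdmissibleSteps (r : ℕ) (ε₁ M η r₁ r₂ : ℝ) : Prop where
  M_pos : 0 < M
  η_pos : 0 < η
  r₁_pos : 0 < r₁
  r₁_le : r₁ ≤ √ε₁ * η / (4 * r ^ 2 * M)
  le_r₂ : 8 * √ε₁ ≤ r₂
  r₂_le : r₂ ≤ 9 * η / (256 * (r - 2) * M)

/-- The subspace `B^⊥` of vectors orthogonal to all members of the list `B`. -/
abbrev perp {n : ℕ} (B : List (EuclideanSpace ℝ (Fin n))) :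
    Submodule ℝ (EuclideanSpace ℝ (Fin n)) :=
  (Submodule.span ℝ {x | x ∈ B})ᗮ

/-- `FindBasisRun F m ε₁ η r₁ r₂ B r`: some execution of the basis finding algorithm with moment
bound `m` reaches the state in which the vectors found so far are `B` (in order of discovery) and
the current moment order is `r`.

The order is raised if `f_r ≡ γ_r` on the unit sphere of `B^⊥`. Otherwise a local
maximum (`σ = 1`) or a local minimum (`σ = -1`) of `f_r` on the unit sphere of `B^⊥` is computed by
running the local search on `σ g_r` inside `B^⊥` from a unit vector `v` with `σ g_r(v) ≥ η_r`. -/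
inductive FindBasisRun {n : ℕ} (F : Measure (EuclideanSpace ℝ (Fin n))) (m : ℕ) (ε₁ : ℝ)
    (η r₁ r₂ : ℕ → ℝ) : List (EuclideanSpace ℝ (Fin n)) → ℕ → Prop
  | start : FindBasisRun F m ε₁ η r₁ r₂ [] 2
  | raise (B : List (EuclideanSpace ℝ (Fin n))) (r : ℕ)
      (hrun : FindBasisRun F m ε₁ η r₁ r₂ B r) (hB : B.length < n) (hr : r ≤ m)
      (hgauss : ∀ v ∈ perp B, ‖v‖ = 1 → dirMoment F r v = gaussMoment r) :
      FindBasisRun F m ε₁ η r₁ r₂ B (r + 1)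
  | find (B : List (EuclideanSpace ℝ (Fin n))) (r : ℕ)
      (hrun : FindBasisRun F m ε₁ η r₁ r₂ B r) (hB : B.length < n) (hr : r ≤ m)
      (σ : ℝ) (hσ : σ = 1 ∨ σ = -1) (v u : perp B) (hv : ‖v‖ = 1)
      (hstart : η r ≤ σ * excess F r v)
      (hopt : LocalOptReturns ε₁ (r₁ r) (r₂ r) r (fun w : perp B => σ * excess F r w) v u) :
      FindBasisRun F m ε₁ η r₁ r₂ (B ++ [(u : EuclideanSpace ℝ (Fin n))]) r

end

/-! Let u be returned by the local search for g = σ g_r inside B^⊥, and put p = ‖π_W u‖. All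
excesses of order below r vanish on B^⊥, so expanding the r-th moment over the independent factors
gives g_r(w) = g_r(π_V w) there (`excess_eq_excess_starProjection`): on B^⊥ the function does not
see the noise. But u has failed the gradient test, so Dg_u is radial up to a relative error 1.44√ε₁
(`abs_fderiv_sub_le`).

Both facts are tested on z, the component of π_W u orthogonal to B. If ‖π_W x‖ ≤ s for x in B, then
⟨u, z⟩ = p², ‖z‖ ≤ p and ‖π_V z‖ ≤ |B| s p. Near-radiality makes Dg_u(z) at least r g(u) (p² -
1.44√ε₁ p); factoring through π_V makes it at most 3 r M |B| s p. Hence (p - 1.44√ε₁) η ≤ 3 M |B| s,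
provided g(u) ≥ η (`norm_starProjection_orthogonal_bound`).

That g(u) ≥ η holds because no search step lowers g once g ≥ η: each step is a rotation along a
great circle, and Taylor's formula controls it. The derivative bounds come from Bernstein's
inequality, since f_r on a great circle is a trigonometric polynomial of degree at most r bounded by
M. Bernstein is proved by Riesz interpolation.

For the induction on the number of vectors let d = ε₁^((1/16)^j). Then s = d^8, η ≥ M d and √ε₁ ≤
d^8, so p ≤ 1.44 d^8 + 3 k d^7; the choice of ε₀ absorbs k, and p² ≤ d (`sq_le_of_error_bound`). -/

/-! ### Trigonometric polynomials. -/

/-- The space of complex trigonometric polynomials of degree at most `n`. -/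
noncomputable def trigSpace (n : ℕ) : Submodule ℂ (ℝ → ℂ) :=
  Submodule.span ℂ {T | ∃ j : ℤ, |j| ≤ n ∧ T = fun t : ℝ => Complex.exp (j * t * Complex.I)}

lemma exp_mem_trigSpace {n : ℕ} {j : ℤ} (hj : |j| ≤ n) :
    (fun t : ℝ => Complex.exp (j * t * Complex.I)) ∈ trigSpace n :=
  Submodule.subset_span ⟨j, hj, rfl⟩

lemma mul_mem_trigSpace {a b : ℕ} {S T : ℝ → ℂ} (hS : S ∈ trigSpace a) (hT : T ∈ trigSpace b) :
    S * T ∈ trigSpace (a + b) := by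
  have h := Submodule.mul_mem_mul hS hT
  rw [trigSpace, trigSpace, Submodule.span_mul_span] at h
  refine Submodule.span_mono ?_ h
  rintro _ ⟨_, ⟨i, hi, rfl⟩, _, ⟨j, hj, rfl⟩, rfl⟩
  refine ⟨i + j, (abs_add_le i j).trans (by push_cast; omega), ?_⟩
  funext t
  simp only [Pi.mul_apply]
  rw [← Complex.exp_add]
  push_cast
  ring_nf

lemma one_mem_trigSpace (n : ℕ) : (1 : ℝ → ℂ) ∈ trigSpace n := by
  convert exp_mem_trigSpace (n := n) (j := 0) (by simp) using 1
  funext t; simp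

lemma pow_mem_trigSpace {T : ℝ → ℂ} (hT : T ∈ trigSpace 1) (n : ℕ) : T ^ n ∈ trigSpace n := by
  induction n with
  | zero => simpa using one_mem_trigSpace 0
  | succ n ih => rw [pow_succ]; exact mul_mem_trigSpace ih hT

lemma cos_mem_trigSpace : (fun t : ℝ => (Real.cos t : ℂ)) ∈ trigSpace 1 := by
  have h := (trigSpace 1).smul_mem (1 / 2 : ℂ) ((trigSpace 1).add_mem
    (exp_mem_trigSpace (n := 1) (j := 1) (by simp))
    (exp_mem_trigSpace (n := 1) (j := -1) (by simp)))
  convert h using 1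
  funext t
  simp [Complex.cos]
  ring

lemma sin_mem_trigSpace : (fun t : ℝ => (Real.sin t : ℂ)) ∈ trigSpace 1 := by
  have h := (trigSpace 1).smul_mem (-Complex.I / 2 : ℂ) ((trigSpace 1).sub_mem
    (exp_mem_trigSpace (n := 1) (j := 1) (by simp))
    (exp_mem_trigSpace (n := 1) (j := -1) (by simp)))
  convert h using 1
  funext t
  simp [Complex.sin]
  ring

/-! ### Riesz interpolation and Bernstein's inequality. -/

/-- The nodes of the Riesz interpolation formula. -/
noncomputable def rieszNode (n k : ℕ) : ℝ := (2 * k + 1) * Real.pi / (2 * n)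

/-- The moduli of the weights of the Riesz interpolation formula. -/
noncomputable def rieszWeight (n k : ℕ) : ℝ :=
  Complex.normSq (∑ l ∈ Finset.range n, Complex.exp (l * rieszNode n k * Complex.I)) / (2 * n)

lemma rieszWeight_nonneg (n k : ℕ) : 0 ≤ rieszWeight n k :=
  div_nonneg (Complex.normSq_nonneg _) (by positivity)

lemma rieszWeight_eq (n k : ℕ) : (rieszWeight n k : ℂ) = (1 / (2 * n)) *
    ∑ l ∈ Finset.range n, ∑ l' ∈ Finset.range n,
      Complex.exp (((l : ℤ) - (l' : ℤ) : ℤ) * rieszNode n k * Complex.I) := by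
  rw [rieszWeight]
  push_cast
  rw [Complex.normSq_eq_conj_mul_self, mul_comm ((starRingEnd ℂ) _), map_sum,
    Finset.sum_mul_sum, div_eq_mul_one_div, mul_comm]
  congr 1
  refine Finset.sum_congr rfl fun l _ => Finset.sum_congr rfl fun l' _ => ?_
  rw [← Complex.exp_conj, ← Complex.exp_add]
  simp
  ring_nf

lemma exp_rieszNode_self {n : ℕ} (hn : 0 < n) (k : ℕ) :
    Complex.exp ((n : ℤ) * rieszNode n k * Complex.I) = Complex.I * (-1) ^ k := by
  have h0 : (n : ℂ) ≠ 0 := by exact_mod_cast hn.ne'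
  have : ((n : ℤ) : ℂ) * rieszNode n k * Complex.I =
      Real.pi / 2 * Complex.I + k * (Real.pi * Complex.I) := by
    rw [rieszNode]; push_cast; field_simp; ring
  rw [this, Complex.exp_add, Complex.exp_nat_mul, Complex.exp_pi_mul_I, Complex.exp_pi_div_two_mul_I]

/-- The terms form a geometric progression with ratio -exp(imπ/n), a 2n-th root of unity. It equals
1 only when m ≡ n mod 2n, which in the range |m| < 2n leaves m = ±n. -/
lemma alternating_sum_exp_rieszNode {n : ℕ} (hn : 0 < n) {m : ℤ} (hm : |m| < 2 * n) :
    ∑ k ∈ Finset.range (2 * n), (-1) ^ k * Complex.exp (m * rieszNode n k * Complex.I) =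
      2 * n * Complex.I * ((if m = n then 1 else 0) - (if m = -n then 1 else 0)) := by
  have h0 : (n : ℂ) ≠ 0 := by exact_mod_cast hn.ne'
  have hnn : ((n : ℤ)) ≠ -n := by omega
  have hsq (k : ℕ) : ((-1 : ℂ)) ^ k * (-1) ^ k = 1 := by rw [← mul_pow]; simp
  by_cases h1 : m = n
  · subst h1
    simp only [exp_rieszNode_self hn, if_pos, if_neg hnn]
    rw [Finset.sum_congr rfl (g := fun _ => Complex.I)]
    · simp
    · intro k _; rw [mul_left_comm, hsq, mul_one]
  by_cases h2 : m = -n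
  · subst h2
    have (k : ℕ) : Complex.exp (((-(n : ℤ) : ℤ) : ℂ) * rieszNode n k * Complex.I) =
        -Complex.I * (-1) ^ k := by
      have := exp_rieszNode_self hn k
      rw [show (((-(n : ℤ) : ℤ) : ℂ) * rieszNode n k * Complex.I) =
        -(((n : ℤ) : ℂ) * rieszNode n k * Complex.I) by push_cast; ring, Complex.exp_neg, this,
        mul_inv, Complex.inv_I, ← inv_pow]
      norm_num
    simp only [this, if_neg h1]
    rw [Finset.sum_congr rfl (g := fun _ => -Complex.I)]
    · simp
    · intro k _; rw [mul_left_comm, hsq, mul_one]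
  · rw [if_neg h1, if_neg h2]
    set z : ℂ := -Complex.exp (m * (Real.pi / n) * Complex.I) with hz
    have hterm (k : ℕ) : (-1) ^ k * Complex.exp (m * rieszNode n k * Complex.I) =
        Complex.exp (m * (Real.pi / (2 * n)) * Complex.I) * z ^ k := by
      rw [hz, neg_pow (Complex.exp _), ← Complex.exp_nat_mul, mul_left_comm, ← Complex.exp_add,
        rieszNode]
      congr 2
      push_cast
      field_simp
      ring
    simp only [hterm]
    rw [← Finset.mul_sum]
    have hz2 : z ^ (2 * n) = 1 := by
      rw [hz, neg_pow (Complex.exp _), ← Complex.exp_nat_mul, pow_mul]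
      have : ((2 * n : ℕ) : ℂ) * (m * (Real.pi / n) * Complex.I) = m * (2 * Real.pi * Complex.I) := by
        push_cast; field_simp
      rw [this, Complex.exp_int_mul_two_pi_mul_I]
      simp
    have hz1 : z ≠ 1 := by
      intro h
      have h3 : Complex.exp (m * (Real.pi / n) * Complex.I + Real.pi * Complex.I) = 1 := by
        rw [Complex.exp_add, Complex.exp_pi_mul_I, mul_neg_one]; exact h
      obtain ⟨q, hq⟩ := Complex.exp_eq_one_iff.1 h3
      have hpi : (Real.pi : ℂ) ≠ 0 := by exact_mod_cast Real.pi_ne_zero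
      have h4 : ((m : ℂ) + n) = q * (2 * n) := by
        field_simp at hq
        linear_combination hq
      have h5 : m + n = q * (2 * n) := by exact_mod_cast h4
      have h6 := abs_lt.1 hm
      have hq1 : q = 0 ∨ q = 1 ∨ q < 0 ∨ 1 < q := by omega
      rcases hq1 with rfl | rfl | hq1 | hq1
      · omega
      · omega
      · nlinarith
      · nlinarith
    rw [geom_sum_eq hz1, hz2]
    simp

/-- Expanding the weight as a double sum over l, l' < n, the alternating sum over nodes keeps only j
+ l - l' = ±n. For fixed l a suitable l' exists exactly when j + l ≥ n or j + l < 0, and the signed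
count of such l is j. -/
lemma rieszFormula_exp {n : ℕ} (hn : 0 < n) {j : ℤ} (hj : |j| ≤ n) :
    ∑ k ∈ Finset.range (2 * n), (-1) ^ k * (rieszWeight n k : ℂ) *
      Complex.exp (j * rieszNode n k * Complex.I) = j * Complex.I := by
  have h0 : (n : ℂ) ≠ 0 := by exact_mod_cast hn.ne'
  have hj' := abs_le.1 hj
  have h1 : ∑ k ∈ Finset.range (2 * n), (-1) ^ k * (rieszWeight n k : ℂ) *
      Complex.exp (j * rieszNode n k * Complex.I) = (1 / (2 * n)) *
      ∑ l ∈ Finset.range n, ∑ l' ∈ Finset.range n, ∑ k ∈ Finset.range (2 * n),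
        (-1) ^ k * Complex.exp ((j + l - l' : ℤ) * rieszNode n k * Complex.I) := by
    rw [Finset.sum_congr rfl fun l _ => Finset.sum_comm, Finset.sum_comm, Finset.mul_sum]
    refine Finset.sum_congr rfl fun k _ => ?_
    rw [rieszWeight_eq, mul_left_comm, mul_assoc, Finset.mul_sum, Finset.sum_mul]
    congr 1
    refine Finset.sum_congr rfl fun l _ => ?_
    rw [Finset.mul_sum, Finset.sum_mul]
    refine Finset.sum_congr rfl fun l' _ => ?_
    rw [mul_assoc, ← Complex.exp_add]
    congr 2
    push_cast
    ring
  have h2 : ∀ l ∈ Finset.range n, ∑ l' ∈ Finset.range n, ∑ k ∈ Finset.range (2 * n),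
        (-1) ^ k * Complex.exp ((j + l - l' : ℤ) * rieszNode n k * Complex.I) =
      2 * n * Complex.I * ((if (n : ℤ) ≤ j + l then 1 else 0) - (if j + l < 0 then 1 else 0)) := by
    intro l hl
    have hl := Finset.mem_range.1 hl
    have h3 : ∀ l' ∈ Finset.range n, _ := fun (l' : ℕ) hl' =>
      alternating_sum_exp_rieszNode hn (m := j + l - l')
        (by have := Finset.mem_range.1 hl'; rw [abs_lt]; omega)
    rw [Finset.sum_congr rfl h3, ← Finset.mul_sum, Finset.sum_sub_distrib]
    congr 2
    · split_ifs with h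
      · rw [Finset.sum_eq_single (j + l - n).toNat]
        · rw [if_pos (by omega)]
        · intro b _ hb; rw [if_neg (by omega)]
        · intro hb; exact absurd (Finset.mem_range.2 (by omega)) hb
      · refine Finset.sum_eq_zero fun b _ => if_neg (by omega)
    · split_ifs with h
      · rw [Finset.sum_eq_single (j + l + n).toNat]
        · rw [if_pos (by omega)]
        · intro b _ hb; rw [if_neg (by omega)]
        · intro hb; exact absurd (Finset.mem_range.2 (by omega)) hb
      · refine Finset.sum_eq_zero fun b hb => if_neg ?_
        have := Finset.mem_range.1 hb
        omega
  rw [h1, Finset.sum_congr rfl h2, ← Finset.mul_sum, Finset.sum_sub_distrib, Finset.sum_boole,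
    Finset.sum_boole]
  have h3 : (((Finset.range n).filter fun l : ℕ => (n : ℤ) ≤ j + l).card : ℤ) -
      ((Finset.range n).filter fun l : ℕ => j + (l : ℤ) < 0).card = j := by
    have e1 : (Finset.range n).filter (fun l : ℕ => (n : ℤ) ≤ j + l) =
        Finset.Ico (n - j.toNat) n := by
      ext l; simp only [Finset.mem_filter, Finset.mem_range, Finset.mem_Ico]; omega
    have e2 : (Finset.range n).filter (fun l : ℕ => j + (l : ℤ) < 0) =
        Finset.range (-j).toNat := by
      ext l; simp only [Finset.mem_filter, Finset.mem_range]; omega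
    rw [e1, e2, Nat.card_Ico, Finset.card_range]
    omega
  have h4 : (((Finset.range n).filter fun l : ℕ => (n : ℤ) ≤ j + l).card : ℂ) -
      ((Finset.range n).filter fun l : ℕ => j + (l : ℤ) < 0).card = j := by exact_mod_cast h3
  rw [h4]
  field_simp

/-- At frequency n the exponential at each node is i(-1)^k, which cancels the alternating sign. -/
lemma sum_rieszWeight {n : ℕ} (hn : 0 < n) :
    ∑ k ∈ Finset.range (2 * n), rieszWeight n k = n := by
  have h := rieszFormula_exp hn (j := n) (by simp)
  have h2 : ∀ k ∈ Finset.range (2 * n), (-1) ^ k * (rieszWeight n k : ℂ) *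
      Complex.exp ((n : ℤ) * rieszNode n k * Complex.I) = rieszWeight n k * Complex.I := by
    intro k _
    rw [exp_rieszNode_self hn]
    have hsq : ((-1 : ℂ)) ^ k * (-1) ^ k = 1 := by rw [← mul_pow]; simp
    linear_combination (rieszWeight n k * Complex.I) * hsq
  rw [Finset.sum_congr rfl h2, ← Finset.sum_mul] at h
  have := mul_right_cancel₀ Complex.I_ne_zero h
  exact_mod_cast this

lemma exists_hasDerivAt_of_mem_trigSpace {n : ℕ} {T : ℝ → ℂ} (hT : T ∈ trigSpace n) :
    ∃ T' ∈ trigSpace n, ∀ s, HasDerivAt T (T' s) s := by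
  induction hT using Submodule.span_induction with
  | mem T hT =>
    obtain ⟨j, hj, rfl⟩ := hT
    refine ⟨_, (trigSpace n).smul_mem (j * Complex.I) (exp_mem_trigSpace hj), fun s => ?_⟩
    have h1 : HasDerivAt (fun t : ℝ => (j : ℂ) * t * Complex.I) (j * 1 * Complex.I) s :=
      ((Complex.ofRealCLM.hasDerivAt (x := s)).const_mul _).mul_const _
    convert h1.cexp using 1
    simp [mul_comm]
  | zero => exact ⟨0, zero_mem _, fun s => hasDerivAt_const s 0⟩
  | add S T _ _ hS hT =>
    obtain ⟨S', hS', h1⟩ := hS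
    obtain ⟨T', hT', h2⟩ := hT
    exact ⟨S' + T', add_mem hS' hT', fun s => (h1 s).add (h2 s)⟩
  | smul c T _ hT =>
    obtain ⟨T', hT', h2⟩ := hT
    exact ⟨c • T', Submodule.smul_mem _ c hT', fun s => (h2 s).const_smul c⟩

lemma rieszFormula {n : ℕ} (hn : 0 < n) {T : ℝ → ℂ} (hT : T ∈ trigSpace n) (s : ℝ) :
    HasDerivAt T (∑ k ∈ Finset.range (2 * n), (-1) ^ k * (rieszWeight n k : ℂ) *
      T (s + rieszNode n k)) s := by
  induction hT using Submodule.span_induction with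
  | mem T hT =>
    obtain ⟨j, hj, rfl⟩ := hT
    have h1 : HasDerivAt (fun t : ℝ => (j : ℂ) * t * Complex.I) (j * 1 * Complex.I) s :=
      ((Complex.ofRealCLM.hasDerivAt (x := s)).const_mul _).mul_const _
    convert h1.cexp using 1
    rw [mul_one, ← rieszFormula_exp hn hj, Finset.mul_sum]
    refine Finset.sum_congr rfl fun k _ => ?_
    rw [mul_left_comm, ← Complex.exp_add]
    push_cast
    ring_nf
  | zero => simp
  | add S T _ _ hS hT =>
    simp only [Pi.add_apply, mul_add, Finset.sum_add_distrib]
    exact hS.add hT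
  | smul c T _ hT =>
    refine (hT.const_smul c).congr_deriv ?_
    rw [Finset.smul_sum]
    refine Finset.sum_congr rfl fun k _ => ?_
    simp only [Pi.smul_apply, smul_eq_mul]
    ring

/-- Bernstein's inequality for trigonometric polynomials. -/
lemma bernstein_inequality {n : ℕ} (hn : 0 < n) {T : ℝ → ℂ} (hT : T ∈ trigSpace n) {K : ℝ}
    (hK : ∀ t, ‖T t‖ ≤ K) {T' : ℂ} {s : ℝ} (h : HasDerivAt T T' s) : ‖T'‖ ≤ n * K := by
  rw [h.unique (rieszFormula hn hT s), ← sum_rieszWeight hn, Finset.sum_mul]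
  refine (norm_sum_le _ _).trans (Finset.sum_le_sum fun k _ => ?_)
  rw [norm_mul, norm_mul, norm_pow, norm_neg, norm_one, one_pow, one_mul, Complex.norm_real,
    Real.norm_of_nonneg (rieszWeight_nonneg n k)]
  exact mul_le_mul_of_nonneg_left (hK _) (rieszWeight_nonneg n k)

/-- Real trigonometric polynomials of degree at most `n`. -/
def IsTrigPoly (n : ℕ) (T : ℝ → ℝ) : Prop := (fun t => (T t : ℂ)) ∈ trigSpace n

/-- The derivative is again a real trigonometric polynomial of the same degree, so the bound can be
iterated to higher derivatives. -/
lemma IsTrigPoly.exists_hasDerivAt {n : ℕ} (hn : 0 < n) {T : ℝ → ℝ} (hT : IsTrigPoly n T) {K : ℝ}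
    (hK : ∀ t, |T t| ≤ K) :
    ∃ T' : ℝ → ℝ, IsTrigPoly n T' ∧ (∀ s, HasDerivAt T (T' s) s) ∧ ∀ s, |T' s| ≤ n * K := by
  obtain ⟨S, hS, h⟩ := exists_hasDerivAt_of_mem_trigSpace hT
  have hre : ∀ s, HasDerivAt T (S s).re s := fun s => by
    have := Complex.reCLM.hasFDerivAt.comp_hasDerivAt s (h s)
    simpa [Function.comp_def] using this
  have heq : ∀ s, ((S s).re : ℂ) = S s := fun s => ((hre s).ofReal_comp).unique (h s)
  refine ⟨fun s => (S s).re, ?_, hre, fun s => ?_⟩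
  · simpa only [IsTrigPoly, heq] using hS
  · have := bernstein_inequality hn hT (K := K) (fun t => by simpa using hK t) (h s)
    rw [← heq] at this
    simpa using this

/-! ### Gaussian moments, directional moments and the excess. -/

section Moments

lemma integrable_pow_gaussianReal (v : NNReal) (r : ℕ) :
    Integrable (fun t : ℝ => t ^ r) (gaussianReal 0 v) := by
  have h := (memLp_id_gaussianReal' (μ := 0) (v := v) (r : ENNReal) (by simp)).integrable_norm_pow'
  refine h.mono (by fun_prop) (Filter.Eventually.of_forall fun t => ?_)
  simp

lemma integral_pow_gaussianReal (c : ℝ) (v : NNReal) (hv : (v : ℝ) = c ^ 2) (r : ℕ) :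
    ∫ t, t ^ r ∂(gaussianReal 0 v) = gaussMoment r * c ^ r := by
  have h := gaussianReal_map_const_mul (μ := 0) (v := 1) c
  have hv' : NNReal.mk (c ^ 2) (sq_nonneg c) * 1 = v := by ext; simp [hv]
  rw [mul_zero, hv'] at h
  rw [← h, integral_map (by fun_prop) (by fun_prop), gaussMoment]
  simp only [mul_pow]
  rw [integral_const_mul, mul_comm]

lemma gaussMoment_zero : gaussMoment 0 = 1 := by simp [gaussMoment]

lemma gaussMoment_one : gaussMoment 1 = 0 := by simp [gaussMoment]

lemma gaussMoment_two : gaussMoment 2 = 1 := by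
  have h := variance_fun_id_gaussianReal (μ := 0) (v := 1)
  rw [variance_eq_integral (by fun_prop)] at h
  simpa [gaussMoment] using h

lemma gaussMoment_nonneg_of_even {r : ℕ} (hr : Even r) : 0 ≤ gaussMoment r :=
  integral_nonneg fun _ => hr.pow_nonneg _

lemma gaussMoment_mul_neg_one_pow (r : ℕ) : gaussMoment r * (-1) ^ r = gaussMoment r := by
  rw [← integral_pow_gaussianReal (-1) 1 (by simp), gaussMoment]

lemma gaussMoment_of_odd {r : ℕ} (hr : Odd r) : gaussMoment r = 0 := by
  have := gaussMoment_mul_neg_one_pow r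
  rw [hr.neg_one_pow] at this
  linarith

lemma gaussMoment_nonneg (r : ℕ) : 0 ≤ gaussMoment r := by
  rcases Nat.even_or_odd r with h | h
  · exact gaussMoment_nonneg_of_even h
  · rw [gaussMoment_of_odd h]

lemma gaussMoment_mul_abs_pow (r : ℕ) (t : ℝ) : gaussMoment r * |t| ^ r = gaussMoment r * t ^ r := by
  rcases Nat.even_or_odd r with h | h
  · rw [h.pow_abs]
  · simp [gaussMoment_of_odd h]

/-- A sum of independent centred Gaussians of variances a² and b² is Gaussian of variance c²;
compare r-th moments. -/
lemma gaussMoment_mul_pow_eq_sum {a b c : ℝ} (h : c ^ 2 = a ^ 2 + b ^ 2) (r : ℕ) :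
    gaussMoment r * c ^ r = ∑ i ∈ Finset.range (r + 1),
      (gaussMoment i * a ^ i) * (gaussMoment (r - i) * b ^ (r - i)) * r.choose i := by
  obtain ⟨va, hva⟩ : ∃ v : NNReal, (v : ℝ) = a ^ 2 := ⟨NNReal.mk (a ^ 2) (sq_nonneg a), rfl⟩
  obtain ⟨vb, hvb⟩ : ∃ v : NNReal, (v : ℝ) = b ^ 2 := ⟨NNReal.mk (b ^ 2) (sq_nonneg b), rfl⟩
  have hconv := gaussianReal_conv_gaussianReal (m₁ := 0) (m₂ := 0) (v₁ := va) (v₂ := vb)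
  rw [add_zero] at hconv
  rw [← integral_pow_gaussianReal c (va + vb) (by push_cast; rw [hva, hvb, h])]
  have hint := integrable_pow_gaussianReal (va + vb) r
  rw [← hconv] at hint ⊢
  rw [integral_conv hint]
  have h1 : ∀ x : ℝ, ∫ y, (x + y) ^ r ∂(gaussianReal 0 vb) =
      ∑ i ∈ Finset.range (r + 1), x ^ i * (gaussMoment (r - i) * b ^ (r - i)) * r.choose i := by
    intro x
    simp only [add_pow]
    rw [integral_finsetSum]
    · refine Finset.sum_congr rfl fun i _ => ?_
      rw [integral_mul_const, integral_const_mul, integral_pow_gaussianReal b _ hvb]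
    · exact fun i _ => ((integrable_pow_gaussianReal _ _).const_mul _).mul_const _
  simp only [h1]
  rw [integral_finsetSum]
  · refine Finset.sum_congr rfl fun i _ => ?_
    rw [integral_mul_const, integral_mul_const, integral_pow_gaussianReal a _ hva]
  · exact fun i _ => ((integrable_pow_gaussianReal _ _).mul_const _).mul_const _

lemma integral_inner_pow_stdGaussian {E : Type*} [NormedAddCommGroup E] [InnerProductSpace ℝ E]
    [FiniteDimensional ℝ E] [MeasurableSpace E] [BorelSpace E] (w : E) (r : ℕ) :
    ∫ x, (inner ℝ x w) ^ r ∂(stdGaussian E) = gaussMoment r * ‖w‖ ^ r := by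
  have h := IsGaussian.map_eq_gaussianReal (μ := stdGaussian E) (innerSL ℝ w)
  rw [integral_strongDual_stdGaussian, variance_dual_stdGaussian, innerSL_apply_norm] at h
  rw [← integral_pow_gaussianReal ‖w‖ (‖w‖ ^ 2).toNNReal (by simp), ← h,
    integral_map (by fun_prop) (by fun_prop)]
  simp only [innerSL_apply_apply, real_inner_comm]

variable {n : ℕ} {F : Measure (EuclideanSpace ℝ (Fin n))}

lemma integrable_norm_pow_of_memLp [IsProbabilityMeasure F] {m r : ℕ}
    (hF : MemLp id (m : ENNReal) F) (hr : r ≤ m) : Integrable (fun x => ‖x‖ ^ r) F :=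
  (hF.mono_exponent (p := (r : ENNReal)) (by exact_mod_cast hr)).integrable_norm_pow'

lemma integrable_inner_pow_mul_inner_pow [IsProbabilityMeasure F] {m : ℕ}
    (hF : MemLp id (m : ENNReal) F) {i j : ℕ} (hr : i + j ≤ m) (u v : EuclideanSpace ℝ (Fin n)) :
    Integrable (fun x => (inner ℝ x u) ^ i * (inner ℝ x v) ^ j) F := by
  refine ((integrable_norm_pow_of_memLp hF hr).mul_const (‖u‖ ^ i * ‖v‖ ^ j)).mono'
    (by fun_prop) (Filter.Eventually.of_forall fun x => ?_)
  rw [norm_mul, norm_pow, norm_pow, pow_add, mul_mul_mul_comm, ← mul_pow, ← mul_pow]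
  gcongr <;> exact abs_real_inner_le_norm _ _

lemma dirMoment_smul (r : ℕ) (t : ℝ) (u : EuclideanSpace ℝ (Fin n)) :
    dirMoment F r (t • u) = t ^ r * dirMoment F r u := by
  simp only [dirMoment, inner_smul_right, mul_pow]
  rw [integral_const_mul]

/-- Homogeneity holds for negative t too, since γ_r = 0 for odd r. The same parity makes γ_r ‖u‖^r
smooth at the origin. -/
lemma excess_smul (r : ℕ) (t : ℝ) (u : EuclideanSpace ℝ (Fin n)) :
    excess F r (t • u) = t ^ r * excess F r u := by
  rw [excess, excess, dirMoment_smul, norm_smul, mul_pow, Real.norm_eq_abs, ← mul_assoc,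
    gaussMoment_mul_abs_pow]
  ring

lemma contDiff_dirMoment [IsProbabilityMeasure F] {m : ℕ}
    (hF : MemLp id (m : ENNReal) F) {r : ℕ} (hr : r ≤ m) : ContDiff ℝ 3 (dirMoment F r) := by
  have h : dirMoment F r = fun u => ∑ p : Fin r → Fin n, (∏ i, u (p i)) * ∫ x, ∏ i, x (p i) ∂F := by
    funext u
    simp only [dirMoment, PiLp.inner_apply, RCLike.inner_apply, conj_trivial, Fintype.sum_pow,
      Finset.prod_mul_distrib]
    rw [integral_finsetSum]
    · simp only [integral_const_mul]
    · intro p _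
      refine Integrable.const_mul ?_ _
      refine (integrable_norm_pow_of_memLp hF hr).mono' (by fun_prop)
        (Filter.Eventually.of_forall fun x => ?_)
      rw [norm_prod]
      refine (Finset.prod_le_prod (fun _ _ => norm_nonneg _)
        fun i _ => PiLp.norm_apply_le x (p i)).trans ?_
      simp
  rw [h]
  fun_prop

lemma contDiff_gaussMoment_mul_norm_pow (r : ℕ) :
    ContDiff ℝ 3 (fun u : EuclideanSpace ℝ (Fin n) => gaussMoment r * ‖u‖ ^ r) := by
  rcases Nat.even_or_odd' r with ⟨s, rfl | rfl⟩
  · simp only [pow_mul]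
    exact contDiff_const.mul ((contDiff_norm_sq ℝ).pow s)
  · simp only [gaussMoment_of_odd ⟨s, rfl⟩, zero_mul]
    exact contDiff_const

lemma contDiff_excess [IsProbabilityMeasure F] {m : ℕ}
    (hF : MemLp id (m : ENNReal) F) {r : ℕ} (hr : r ≤ m) : ContDiff ℝ 3 (excess F r) :=
  (contDiff_dirMoment hF hr).sub (contDiff_gaussMoment_mul_norm_pow r)

lemma isTrigPoly_dirMoment [IsProbabilityMeasure F] {m : ℕ}
    (hF : MemLp id (m : ENNReal) F) {r : ℕ} (hr : r ≤ m) (u v : EuclideanSpace ℝ (Fin n)) :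
    IsTrigPoly r (fun t => dirMoment F r (Real.cos t • u + Real.sin t • v)) := by
  have h : (fun t : ℝ => (dirMoment F r (Real.cos t • u + Real.sin t • v) : ℂ)) =
      ∑ i ∈ Finset.range (r + 1),
        (((∫ x, (inner ℝ x u) ^ i * (inner ℝ x v) ^ (r - i) ∂F) * r.choose i : ℝ) : ℂ) •
        ((fun t : ℝ => (Real.cos t : ℂ)) ^ i * (fun t : ℝ => (Real.sin t : ℂ)) ^ (r - i)) := by
    funext t
    simp only [dirMoment, inner_add_right, inner_smul_right, add_pow]
    rw [integral_finsetSum]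
    · simp only [Finset.sum_apply, Pi.smul_apply, Pi.mul_apply, Pi.pow_apply, Complex.ofReal_sum,
        smul_eq_mul]
      refine Finset.sum_congr rfl fun i _ => ?_
      rw [← Complex.ofReal_pow, ← Complex.ofReal_pow, ← Complex.ofReal_mul, ← Complex.ofReal_mul]
      congr 1
      rw [integral_mul_const]
      simp only [mul_pow, mul_mul_mul_comm]
      rw [integral_const_mul]
      ring
    · intro i hi
      have hi := Finset.mem_range_succ_iff.1 hi
      have h1 := integrable_inner_pow_mul_inner_pow hF (i := i) (j := r - i) (by omega) u v
      refine ((h1.const_mul (Real.cos t ^ i * Real.sin t ^ (r - i))).mul_const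
        (r.choose i : ℝ)).congr (Filter.Eventually.of_forall fun x => ?_)
      simp only
      ring
  rw [IsTrigPoly, h]
  refine Submodule.sum_mem _ fun i hi => Submodule.smul_mem _ _ ?_
  have hi := Finset.mem_range_succ_iff.1 hi
  have := mul_mem_trigSpace (pow_mem_trigSpace cos_mem_trigSpace i)
    (pow_mem_trigSpace sin_mem_trigSpace (r - i))
  rwa [Nat.add_sub_cancel' hi] at this

lemma dirMoment_split [IsProbabilityMeasure F] {m : ℕ} (hF : MemLp id (m : ENNReal) F)
    {V : Submodule ℝ (EuclideanSpace ℝ (Fin n))} (hV : FactorsWithGaussianNoise F V)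
    {r : ℕ} (hr : r ≤ m) (u : EuclideanSpace ℝ (Fin n)) :
    dirMoment F r u = ∑ i ∈ Finset.range (r + 1), dirMoment F i (V.starProjection u) *
      (gaussMoment (r - i) * ‖Vᗮ.starProjection u‖ ^ (r - i)) * r.choose i := by
  have h : ∀ x : EuclideanSpace ℝ (Fin n), inner ℝ x u =
      inner ℝ x (V.starProjection u) + inner ℝ x (Vᗮ.starProjection u) := fun x => by
    rw [← inner_add_right, Submodule.starProjection_add_starProjection_orthogonal]
  have hP (K : Submodule ℝ (EuclideanSpace ℝ (Fin n))) (x : EuclideanSpace ℝ (Fin n)) :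
      inner ℝ x (K.starProjection u) =
        inner ℝ (K.orthogonalProjectionOnto x) (K.orthogonalProjectionOnto u) := by
    rw [Submodule.starProjection_apply, ← Submodule.inner_orthogonalProjectionOnto_eq_of_mem_right]
  have hG (i : ℕ) : ∫ x, (inner ℝ x (Vᗮ.starProjection u)) ^ i ∂F =
      gaussMoment i * ‖Vᗮ.starProjection u‖ ^ i := by
    have h1 := integral_inner_pow_stdGaussian (Vᗮ.orthogonalProjectionOnto u) i
    rw [← hV.gaussian, integral_map (by fun_prop) (by fun_prop)] at h1
    simp only [hP Vᗮ]
    exact h1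
  simp only [dirMoment, h, add_pow]
  rw [integral_finsetSum]
  · refine Finset.sum_congr rfl fun i _ => ?_
    rw [integral_mul_const, ← hG]
    congr 1
    have := (hV.indep.comp (φ := fun y => (inner ℝ y (V.orthogonalProjectionOnto u)) ^ i)
      (ψ := fun y => (inner ℝ y (Vᗮ.orthogonalProjectionOnto u)) ^ (r - i))
      (by fun_prop) (by fun_prop)).integral_mul_eq_mul_integral (by fun_prop) (by fun_prop)
    simp only [hP]
    exact this
  · intro i hi
    have hi := Finset.mem_range_succ_iff.1 hi
    exact (integrable_inner_pow_mul_inner_pow hF (by omega) _ _).mul_const _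

/-- The moments of F and those of a standard Gaussian satisfy the same binomial splitting over V and
W, so their difference does. -/
lemma excess_split [IsProbabilityMeasure F] {m : ℕ} (hF : MemLp id (m : ENNReal) F)
    {V : Submodule ℝ (EuclideanSpace ℝ (Fin n))} (hV : FactorsWithGaussianNoise F V)
    {r : ℕ} (hr : r ≤ m) (u : EuclideanSpace ℝ (Fin n)) :
    excess F r u = ∑ i ∈ Finset.range (r + 1), excess F i (V.starProjection u) *
      (gaussMoment (r - i) * ‖Vᗮ.starProjection u‖ ^ (r - i)) * r.choose i := by
  simp only [excess, sub_mul, Finset.sum_sub_distrib]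
  rw [← dirMoment_split hF hV hr, ← gaussMoment_mul_pow_eq_sum
    (Submodule.norm_sq_eq_add_norm_sq_starProjection u V)]

/-- By induction on r, each term of order i < r in the splitting has factor g_i(π_V u) = g_i(u) = 0.
Only the term of order r survives. -/
lemma excess_eq_excess_starProjection [IsProbabilityMeasure F] {m : ℕ}
    (hF : MemLp id (m : ENNReal) F) {V U : Submodule ℝ (EuclideanSpace ℝ (Fin n))}
    (hV : FactorsWithGaussianNoise F V) {r : ℕ} (hr : r ≤ m)
    (hU : ∀ l < r, ∀ u ∈ U, excess F l u = 0) {u : EuclideanSpace ℝ (Fin n)} (hu : u ∈ U) :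
    excess F r u = excess F r (V.starProjection u) := by
  induction r using Nat.strong_induction_on with
  | _ r ih =>
    rw [excess_split hF hV hr, Finset.sum_range_succ, Finset.sum_eq_zero, zero_add]
    · simp [gaussMoment_zero]
    · intro i hi
      have hi := Finset.mem_range.1 hi
      rw [← ih i hi (by omega) (fun l hl => hU l (hl.trans hi)), hU i hi u hu]
      simp

end Moments

/-! ### One-sided Taylor estimates. -/

section Taylor

lemma nonneg_of_hasDerivAt_nonneg {h h' : ℝ → ℝ} (hd : ∀ t, HasDerivAt h (h' t) t)
    (h0 : 0 ≤ h 0) (hp : ∀ t, 0 ≤ t → 0 ≤ h' t) {t : ℝ} (ht : 0 ≤ t) : 0 ≤ h t := by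
  have hm : MonotoneOn h (Set.Ici 0) := monotoneOn_of_deriv_nonneg (convex_Ici 0)
    (fun x _ => (hd x).continuousAt.continuousWithinAt)
    (fun x _ => (hd x).differentiableAt.differentiableWithinAt) fun x hx => by
      rw [interior_Ici, Set.mem_Ioi] at hx
      rw [(hd x).deriv]
      exact hp x hx.le
  exact h0.trans (hm (Set.mem_Ici.2 le_rfl) (Set.mem_Ici.2 ht) ht)

lemma arctan_le_self {x : ℝ} (hx : 0 ≤ x) : Real.arctan x ≤ x := by
  have := Real.le_tan (Real.arctan_nonneg.2 hx) (Real.arctan_lt_pi_div_two x)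
  rwa [Real.tan_arctan] at this

lemma taylor_one_lower {q q₁ : ℝ → ℝ} {C : ℝ} (h₁ : ∀ t, HasDerivAt q (q₁ t) t)
    (hC : ∀ t, |q₁ t| ≤ C) {t : ℝ} (ht : 0 ≤ t) : q 0 - C * t ≤ q t := by
  have := nonneg_of_hasDerivAt_nonneg (h := fun t => q t - q 0 + C * t) (h' := fun t => q₁ t + C * 1)
    (fun t => ((h₁ t).sub_const _).add ((hasDerivAt_id' t).const_mul C)) (by simp)
    (fun t _ => by linarith [(abs_le.1 (hC t)).1]) ht
  linarith

/-- The derivative of the remainder is the remainder one order lower for q₁, so nonnegativity passes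
up. -/
lemma taylor_two_lower {q q₁ q₂ : ℝ → ℝ} {C : ℝ} (h₁ : ∀ t, HasDerivAt q (q₁ t) t)
    (h₂ : ∀ t, HasDerivAt q₁ (q₂ t) t) (hC : ∀ t, |q₂ t| ≤ C) {t : ℝ} (ht : 0 ≤ t) :
    q 0 + q₁ 0 * t - C * t ^ 2 / 2 ≤ q t := by
  have := nonneg_of_hasDerivAt_nonneg (h := fun t => q t - q 0 - q₁ 0 * t + C * t ^ 2 / 2)
    (h' := fun t => q₁ t - q₁ 0 + C * t)
    (fun t => by
      refine ((((h₁ t).sub_const (q 0)).sub ((hasDerivAt_id' t).const_mul (q₁ 0))).add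
        ((((hasDerivAt_id' t).pow 2).const_mul C).div_const 2)).congr_deriv ?_
      norm_num
      ring) (by simp)
    (fun t ht => by linarith [taylor_one_lower h₂ hC ht]) ht
  linarith

lemma taylor_three_lower {q q₁ q₂ q₃ : ℝ → ℝ} {C : ℝ} (h₁ : ∀ t, HasDerivAt q (q₁ t) t)
    (h₂ : ∀ t, HasDerivAt q₁ (q₂ t) t) (h₃ : ∀ t, HasDerivAt q₂ (q₃ t) t) (hC : ∀ t, |q₃ t| ≤ C)
    {t : ℝ} (ht : 0 ≤ t) : q 0 + q₁ 0 * t + q₂ 0 * t ^ 2 / 2 - C * t ^ 3 / 6 ≤ q t := by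
  have := nonneg_of_hasDerivAt_nonneg
    (h := fun t => q t - q 0 - q₁ 0 * t - q₂ 0 * t ^ 2 / 2 + C * t ^ 3 / 6)
    (h' := fun t => q₁ t - q₁ 0 - q₂ 0 * t + C * t ^ 2 / 2)
    (fun t => by
      refine (((((h₁ t).sub_const (q 0)).sub ((hasDerivAt_id' t).const_mul (q₁ 0))).sub
        ((((hasDerivAt_id' t).pow 2).const_mul (q₂ 0)).div_const 2)).add
        ((((hasDerivAt_id' t).pow 3).const_mul C).div_const 6)).congr_deriv ?_
      norm_num
      ring) (by simp)
    (fun t ht => by linarith [taylor_two_lower h₂ h₃ hC ht]) ht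
  linarith

end Taylor

/-! ### Ascent of the local search along great circles. -/

section Search

variable {E : Type*} [NormedAddCommGroup E] [InnerProductSpace ℝ E]

/-- The great circle through the orthonormal pair `u`, `v`. -/
noncomputable def circ (u v : E) (t : ℝ) : E := Real.cos t • u + Real.sin t • v

lemma circ_zero (u v : E) : circ u v 0 = u := by simp [circ]

lemma hasDerivAt_circ (u v : E) (t : ℝ) :
    HasDerivAt (circ u v) (-Real.sin t • u + Real.cos t • v) t :=
  ((Real.hasDerivAt_cos t).smul_const u).add ((Real.hasDerivAt_sin t).smul_const v)

lemma norm_circ {u v : E} (hu : ‖u‖ = 1) (hv : ‖v‖ = 1) (huv : inner ℝ u v = 0) (t : ℝ) :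
    ‖circ u v t‖ = 1 := by
  have h : ‖circ u v t‖ ^ 2 = 1 := by
    rw [circ, norm_add_sq_real, norm_smul, norm_smul, inner_smul_left, inner_smul_right, huv, hu, hv]
    simp
  nlinarith [norm_nonneg (circ u v t)]

lemma renormalize_add_smul {u v : E} (hu : ‖u‖ = 1) (hv : ‖v‖ = 1) (huv : inner ℝ u v = 0)
    (ρ : ℝ) : renormalize (u + ρ • v) = circ u v (Real.arctan ρ) := by
  have h : ‖u + ρ • v‖ = √(1 + ρ ^ 2) := by
    rw [← Real.sqrt_sq (norm_nonneg _), norm_add_sq_real, norm_smul, inner_smul_right, huv, hu, hv]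
    simp
  rw [renormalize, circ, h, Real.cos_arctan, Real.sin_arctan, smul_add, smul_smul]
  simp only [div_eq_inv_mul, mul_one]

/-- `g` restricted to every great circle has its first three derivatives bounded by
`r M`, `r² M` and `r³ M`. -/
def CircleDerivBounds (g : E → ℝ) (r : ℕ) (M : ℝ) : Prop :=
  ∀ u v : E, ‖u‖ = 1 → ‖v‖ = 1 → inner ℝ u v = 0 → ∃ q₁ q₂ q₃ : ℝ → ℝ,
    (∀ t, HasDerivAt (fun t => g (circ u v t)) (q₁ t) t) ∧ (∀ t, HasDerivAt q₁ (q₂ t) t) ∧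
    (∀ t, HasDerivAt q₂ (q₃ t) t) ∧ (∀ t, |q₁ t| ≤ r * M) ∧ (∀ t, |q₂ t| ≤ r ^ 2 * M) ∧
    ∀ t, |q₃ t| ≤ r ^ 3 * M

lemma fderiv_self_of_homogeneous {g : E → ℝ} {r : ℕ} (hg : ContDiff ℝ 3 g)
    (hhom : ∀ (t : ℝ) u, g (t • u) = t ^ r * g u) (u : E) : fderiv ℝ g u u = r * g u := by
  have h1 : HasDerivAt (fun t : ℝ => g (t • u)) (fderiv ℝ g u u) 1 := by
    have hd : HasFDerivAt g (fderiv ℝ g u) ((1 : ℝ) • u) := by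
      rw [one_smul]; exact (hg.differentiable (by norm_num) u).hasFDerivAt
    have h2 := hd.comp_hasDerivAt (1 : ℝ) ((hasDerivAt_id' (1 : ℝ)).smul_const u)
    rw [one_smul] at h2
    exact h2
  have h3 : HasDerivAt (fun t : ℝ => t ^ r * g u) (r * g u) 1 := by
    simpa using (hasDerivAt_pow r (1 : ℝ)).mul_const (g u)
  simp only [hhom] at h1
  exact h1.unique h3

lemma deriv_circ_one {g : E → ℝ} (hg : ContDiff ℝ 3 g) {u v : E} {q₁ : ℝ → ℝ}
    (h₁ : ∀ t, HasDerivAt (fun t => g (circ u v t)) (q₁ t) t) (t : ℝ) :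
    q₁ t = fderiv ℝ g (circ u v t) (-Real.sin t • u + Real.cos t • v) :=
  (h₁ t).unique ((hg.differentiable (by norm_num) _).hasFDerivAt.comp_hasDerivAt t
    (hasDerivAt_circ u v t))

lemma deriv_circ_one_zero {g : E → ℝ} (hg : ContDiff ℝ 3 g) {u v : E} {q₁ : ℝ → ℝ}
    (h₁ : ∀ t, HasDerivAt (fun t => g (circ u v t)) (q₁ t) t) : q₁ 0 = fderiv ℝ g u v := by
  rw [deriv_circ_one hg h₁, circ_zero]
  simp

/-- The first derivative term appears because the great circle has acceleration -u at time 0. -/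
lemma deriv_circ_two_zero {g : E → ℝ} (hg : ContDiff ℝ 3 g) {u v : E} {q₁ q₂ : ℝ → ℝ}
    (h₁ : ∀ t, HasDerivAt (fun t => g (circ u v t)) (q₁ t) t)
    (h₂ : ∀ t, HasDerivAt q₁ (q₂ t) t) : q₂ 0 = hessForm g u v - fderiv ℝ g u u := by
  have hd : Differentiable ℝ (fderiv ℝ g) :=
    (hg.fderiv_right (m := 1) (by norm_num)).differentiable (by norm_num)
  have h3 := ((hd (circ u v 0)).hasFDerivAt.comp_hasDerivAt (0 : ℝ) (hasDerivAt_circ u v 0)).clm_apply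
    (((Real.hasDerivAt_sin 0).neg.smul_const u).add ((Real.hasDerivAt_cos 0).smul_const v))
  have h4 : q₁ = fun t => fderiv ℝ g (circ u v t) (-Real.sin t • u + Real.cos t • v) :=
    funext (deriv_circ_one hg h₁)
  have h5 := h₂ 0
  rw [h4] at h5
  rw [h5.unique h3]
  simp [circ_zero, hessForm, sub_eq_add_neg]

variable [CompleteSpace E]

lemma inner_self_tangentGradient {g : E → ℝ} {u : E} (hu : ‖u‖ = 1) :
    inner ℝ u (tangentGradient g u) = 0 := by
  rw [tangentGradient, inner_sub_right, inner_smul_right, real_inner_self_eq_norm_sq, hu]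
  ring

lemma norm_sq_gradient {g : E → ℝ} {u : E} (hu : ‖u‖ = 1) :
    ‖∇ g u‖ ^ 2 = (inner ℝ u (∇ g u)) ^ 2 + ‖tangentGradient g u‖ ^ 2 := by
  rw [tangentGradient, norm_sub_sq_real, inner_smul_right, norm_smul, hu, real_inner_comm u (∇ g u),
    mul_one, Real.norm_eq_abs, sq_abs]
  ring

lemma inner_self_gradient {g : E → ℝ} {r : ℕ} (hg : ContDiff ℝ 3 g)
    (hhom : ∀ (t : ℝ) u, g (t • u) = t ^ r * g u) (u : E) : inner ℝ u (∇ g u) = r * g u := by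
  rw [real_inner_comm, inner_gradient_left, fderiv_self_of_homogeneous hg hhom]

lemma sqrt_mul_le_norm_tangentGradient {g : E → ℝ} {u : E} {ε : ℝ} (hu : ‖u‖ = 1)
    (hε : 0 < ε) (hε1 : ε ≤ 1 / 100) (h : GradientCond ε g u) :
    √ε * |inner ℝ u (∇ g u)| ≤ ‖tangentGradient g u‖ := by
  have h1 := norm_sq_gradient (g := g) hu
  set a := inner ℝ u (∇ g u) with ha
  have h2 : a ^ 2 ≤ (1 - ε) ^ 2 * ‖∇ g u‖ ^ 2 := by
    rw [← sq_abs a, ← mul_pow]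
    exact pow_le_pow_left₀ (abs_nonneg _) h 2
  refine abs_le_of_sq_le_sq' ?_ (norm_nonneg _) |>.2
  rw [mul_pow, Real.sq_sqrt hε.le, sq_abs]
  rw [h1] at h2
  have h3 : 0 ≤ ε * (1 - ε) * a ^ 2 := by have : 0 ≤ 1 - ε := by linarith
                                          positivity
  have h4 : (1 - ε) ^ 2 * ‖tangentGradient g u‖ ^ 2 ≤ ‖tangentGradient g u‖ ^ 2 := by
    have : (1 - ε) ^ 2 ≤ 1 := by nlinarith
    nlinarith [sq_nonneg ‖tangentGradient g u‖]
  nlinarith [sq_nonneg a]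

/-- With radial part a and tangential part τ, the failed test gives (1-ε)²(a² + ‖τ‖²) ≤ a². The
constant comes from 2/0.98 ≤ 1.44². -/
lemma norm_tangentGradient_le {g : E → ℝ} {u : E} {ε : ℝ} (hu : ‖u‖ = 1)
    (hε : 0 < ε) (hε1 : ε ≤ 1 / 100) (h : ¬ GradientCond ε g u) :
    ‖tangentGradient g u‖ ≤ 1.44 * √ε * |inner ℝ u (∇ g u)| := by
  have h1 := norm_sq_gradient (g := g) hu
  rw [GradientCond, not_le] at h
  set a := inner ℝ u (∇ g u) with ha
  have h2 : (1 - ε) ^ 2 * ‖∇ g u‖ ^ 2 ≤ a ^ 2 := by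
    rw [← sq_abs a, ← mul_pow]
    exact pow_le_pow_left₀ (mul_nonneg (by linarith) (norm_nonneg _)) h.le 2
  refine abs_le_of_sq_le_sq' ?_ (by positivity) |>.2
  rw [mul_pow, mul_pow, Real.sq_sqrt hε.le, sq_abs]
  rw [h1] at h2
  have h4 : 0.98 * ‖tangentGradient g u‖ ^ 2 ≤ (1 - ε) ^ 2 * ‖tangentGradient g u‖ ^ 2 := by
    gcongr
    nlinarith
  nlinarith [sq_nonneg a, mul_nonneg hε.le (sq_nonneg a), mul_nonneg (sq_nonneg ε) (sq_nonneg a)]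

lemma abs_fderiv_sub_le {g : E → ℝ} {r : ℕ} (hg : ContDiff ℝ 3 g)
    (hhom : ∀ (t : ℝ) u, g (t • u) = t ^ r * g u) {u : E} {ε : ℝ} (hu : ‖u‖ = 1)
    (hgu : 0 ≤ g u) (hε : 0 < ε) (hε1 : ε ≤ 1 / 100) (h : ¬ GradientCond ε g u) (z : E) :
    |fderiv ℝ g u z - r * g u * inner ℝ u z| ≤ 1.44 * √ε * (r * g u) * ‖z‖ := by
  have h1 : fderiv ℝ g u z - r * g u * inner ℝ u z = inner ℝ (tangentGradient g u) z := by
    rw [tangentGradient, inner_sub_left, inner_smul_left, inner_gradient_left,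
      inner_self_gradient hg hhom]
    simp
  rw [h1]
  refine (abs_real_inner_le_norm _ _).trans ?_
  gcongr
  have := norm_tangentGradient_le hu hε hε1 h
  rwa [inner_self_gradient hg hhom, abs_of_nonneg (by positivity)] at this

/-- The initial slope is ‖τ‖ ≥ √ε r g(u), and the bound on r₁ makes r² M φ ≤ ‖τ‖, so the quadratic
loss is at most half the linear gain. -/
lemma le_of_first_step {g : E → ℝ} {r : ℕ} (hr : 3 ≤ r) (hg : ContDiff ℝ 3 g)
    (hhom : ∀ (t : ℝ) u, g (t • u) = t ^ r * g u) {M η ε r₁ r₂ : ℝ}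
    (hcirc : CircleDerivBounds g r M) (hadm : AdmissibleSteps r ε M η r₁ r₂)
    (hε : 0 < ε) (hε1 : ε ≤ 1 / 100) {u : E} (hu : ‖u‖ = 1) (hgu : η ≤ g u)
    (h : GradientCond ε g u) :
    ‖renormalize (u + (r₁ / ‖tangentGradient g u‖) • tangentGradient g u)‖ = 1 ∧
      η ≤ g (renormalize (u + (r₁ / ‖tangentGradient g u‖) • tangentGradient g u)) := by
  obtain ⟨hM, hη, hr1, hr1', -, -⟩ := hadm
  have hs := Real.sqrt_pos.2 hε
  have hrpos : (3 : ℝ) ≤ r := by exact_mod_cast hr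
  have hgpos : 0 < g u := hη.trans_le hgu
  have ht := sqrt_mul_le_norm_tangentGradient hu hε hε1 h
  rw [inner_self_gradient hg hhom, abs_of_nonneg (by positivity)] at ht
  have htpos : 0 < ‖tangentGradient g u‖ := lt_of_lt_of_le (by positivity) ht
  set τ := tangentGradient g u with hτ
  have hv : ‖‖τ‖⁻¹ • τ‖ = 1 := by
    rw [norm_smul, norm_inv, norm_norm, inv_mul_cancel₀ htpos.ne']
  have huv : inner ℝ u (‖τ‖⁻¹ • τ) = 0 := by
    rw [inner_smul_right, hτ, inner_self_tangentGradient hu, mul_zero]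
  rw [div_eq_mul_inv, mul_smul, renormalize_add_smul hu hv huv]
  refine ⟨norm_circ hu hv huv _, hgu.trans ?_⟩
  obtain ⟨q₁, q₂, q₃, h1, h2, -, -, hC, -⟩ := hcirc u _ hu hv huv
  set φ := Real.arctan r₁ with hφ
  have hφ0 : 0 ≤ φ := Real.arctan_nonneg.2 hr1.le
  have hφ1 : φ ≤ r₁ := arctan_le_self hr1.le
  have hT := taylor_two_lower h1 h2 hC hφ0
  have hq : q₁ 0 = ‖τ‖ := by
    rw [deriv_circ_one_zero hg h1, ← inner_gradient_left, inner_smul_right]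
    have : ∇ g u = τ + (inner ℝ u (∇ g u)) • u := by rw [hτ, tangentGradient]; abel
    rw [this, inner_add_left, inner_smul_left, hτ, inner_self_tangentGradient hu,
      real_inner_self_eq_norm_sq, ← hτ]
    field_simp
    simp
  simp only [circ_zero] at hT
  rw [hq] at hT
  refine le_trans ?_ hT
  have h5 : r ^ 2 * M * r₁ ≤ √ε * η / 4 := by
    rw [le_div_iff₀ (by positivity)] at hr1'
    linarith
  have h6 : r ^ 2 * M * φ ≤ ‖τ‖ := by
    have h7 : (r : ℝ) ^ 2 * M * φ ≤ r ^ 2 * M * r₁ := by gcongr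
    have h8 : √ε * η / 4 ≤ √ε * (r * g u) := by
      have : η / 4 ≤ r * g u := by nlinarith
      calc √ε * η / 4 = √ε * (η / 4) := by ring
        _ ≤ _ := by gcongr
    linarith
  have h9 := mul_le_mul_of_nonneg_right h6 hφ0
  have h10 : 0 ≤ ‖τ‖ * φ := by positivity
  nlinarith

/-- The eigenvector's sign is arbitrary, so the slope may be negative; it is only of size √ε. The
lower bound on r₂ lets the second-order gain outweigh it, and the upper bound keeps the cubic error
small. -/
lemma le_of_second_step {g : E → ℝ} {r : ℕ} (hr : 3 ≤ r) (hg : ContDiff ℝ 3 g)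
    (hhom : ∀ (t : ℝ) u, g (t • u) = t ^ r * g u) {M η ε r₁ r₂ : ℝ}
    (hcirc : CircleDerivBounds g r M) (hadm : AdmissibleSteps r ε M η r₁ r₂) (hηM : η ≤ 2 * M)
    (hε : 0 < ε) (hε1 : ε ≤ 1 / 100) {u v : E} (hu : ‖u‖ = 1) (hgu : η ≤ g u)
    (h : ¬ GradientCond ε g u) (hv : IsTopEigenvector g u v)
    (hh : hessThreshold r g u ≤ hessForm g u v) :
    ‖renormalize (u - r₂ • v)‖ = 1 ∧ η ≤ g (renormalize (u - r₂ • v)) := by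
  obtain ⟨hM, hη, -, -, hr2, hr2'⟩ := hadm
  have hs := Real.sqrt_pos.2 hε
  have hrr : (3 : ℝ) ≤ r := by exact_mod_cast hr
  have hv1 : ‖-v‖ = 1 := by rw [norm_neg, hv.norm_eq]
  have huv : inner ℝ u (-v) = 0 := by rw [inner_neg_right, hv.orth, neg_zero]
  rw [sub_eq_add_neg, ← smul_neg, renormalize_add_smul hu hv1 huv]
  refine ⟨norm_circ hu hv1 huv _, hgu.trans ?_⟩
  obtain ⟨q₁, q₂, q₃, h1, h2, h3, -, -, hC⟩ := hcirc u _ hu hv1 huv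
  have hr2M : r₂ * (256 * (r - 2) * M) ≤ 9 * η := by
    rwa [le_div_iff₀ (by have : (0 : ℝ) < r - 2 := by linarith
                         positivity)] at hr2'
  have hr2pos : 0 < r₂ := lt_of_lt_of_le (by positivity) hr2
  have hr2small : r₂ ≤ 0.14 := by
    have h4 : r₂ * 256 * M ≤ 18 * M := by
      have : r₂ * (256 * 1 * M) ≤ r₂ * (256 * (r - 2) * M) := by gcongr; linarith
      linarith
    have h5 := le_of_mul_le_mul_right h4 hM
    linarith
  set φ := Real.arctan r₂ with hφ
  have hφ0 : 0 < φ := Real.arctan_pos.2 hr2pos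
  have hφ1 : φ ≤ r₂ := arctan_le_self hr2pos.le
  have hφ2 : 0.99 * r₂ ≤ φ := by
    refine le_trans ?_ (Real.sin_le hφ0.le)
    rw [hφ, Real.sin_arctan, le_div_iff₀ (by positivity)]
    have : √(1 + r₂ ^ 2) ≤ 1.01 := by
      rw [Real.sqrt_le_left (by norm_num)]
      nlinarith
    nlinarith
  have hT := taylor_three_lower h1 h2 h3 hC hφ0.le
  simp only [circ_zero] at hT
  refine le_trans ?_ hT
  have hgpos : 0 < g u := hη.trans_le hgu
  have hq1 : -(1.44 * √ε * (r * g u)) ≤ q₁ 0 := by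
    rw [deriv_circ_one_zero hg h1]
    have := (abs_le.1 (abs_fderiv_sub_le hg hhom hu hgpos.le hε hε1 h (-v))).1
    rw [huv, hv1] at this
    linarith
  -- The threshold 3r(r-1)g/4 minus the Euler term r g.
  have hq2 : r * g u * (3 * r - 7) / 4 ≤ q₂ 0 := by
    rw [deriv_circ_two_zero hg h1 h2, fderiv_self_of_homogeneous hg hhom]
    have : hessForm g u (-v) = hessForm g u v := by simp [hessForm]
    rw [this]
    rw [hessThreshold] at hh
    linarith
  -- From √ε ≤ r₂/8 and r₂ ≤ φ/0.99.
  have e1 : 1.44 * √ε ≤ 0.182 * φ := by linarith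
  have e2 : (r - 2) * (M * φ) ≤ 9 / 256 * g u := by
    have : (r - 2) * (M * φ) ≤ (r - 2) * (M * r₂) := by
      have : (0 : ℝ) ≤ r - 2 := by linarith
      gcongr
    linarith
  -- The required Taylor inequality divided by rφ²; the tightest case is r = 3.
  have e3 : 0.182 * g u + r ^ 2 * (M * φ) / 6 ≤ g u * (3 * r - 7) / 8 := by
    have hr2 : (0 : ℝ) < r - 2 := by linarith
    refine le_of_mul_le_mul_left ?_ hr2
    have e4 : (r : ℝ) ^ 2 * ((r - 2) * (M * φ)) ≤ r ^ 2 * (9 / 256 * g u) := by gcongr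
    have e5 : 0 ≤ g u * ((3 * r - 7) * (r - 2) / 8 - 0.182 * (r - 2) - r ^ 2 * (9 / 256) / 6) := by
      apply mul_nonneg hgpos.le
      nlinarith
    linarith
  have e6 : -(1.44 * √ε * (r * g u)) * φ ≤ q₁ 0 * φ := by gcongr
  have e7 : r * g u * (3 * r - 7) / 4 * φ ^ 2 / 2 ≤ q₂ 0 * φ ^ 2 / 2 := by gcongr
  have e8 : 1.44 * √ε * (r * g u * φ) ≤ 0.182 * φ * (r * g u * φ) := by gcongr
  have e9 := mul_le_mul_of_nonneg_left e3 (a := r * φ ^ 2) (by positivity)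
  linarith

lemma LocalOptReturns.norm_eq_and_le {g : E → ℝ} {r : ℕ} (hr : 3 ≤ r) (hg : ContDiff ℝ 3 g)
    (hhom : ∀ (t : ℝ) u, g (t • u) = t ^ r * g u) {M η ε r₁ r₂ : ℝ}
    (hcirc : CircleDerivBounds g r M) (hadm : AdmissibleSteps r ε M η r₁ r₂) (hηM : η ≤ 2 * M)
    (hε : 0 < ε) (hε1 : ε ≤ 1 / 100) {u₀ u : E} (hu : ‖u₀‖ = 1) (hgu : η ≤ g u₀)
    (h : LocalOptReturns ε r₁ r₂ r g u₀ u) : ‖u‖ = 1 ∧ η ≤ g u := by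
  obtain ⟨hrun, -, -⟩ := h
  induction hrun with
  | refl => exact ⟨hu, hgu⟩
  | tail _ hstep ih =>
    obtain ⟨ih1, ih2⟩ := ih
    cases hstep with
    | first h => exact le_of_first_step hr hg hhom hcirc hadm hε hε1 ih1 ih2 h
    | second v h hv h2 =>
      exact le_of_second_step hr hg hhom hcirc hadm hηM hε hε1 ih1 ih2 h hv h2

end Search

/-! ### From bounds on great circles to bounds on the gradient. -/

section CircleBounds

variable {E : Type*} [NormedAddCommGroup E] [InnerProductSpace ℝ E]

lemma CircleDerivBounds.restrict {g : E → ℝ} {r : ℕ} {M : ℝ} (h : CircleDerivBounds g r M)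
    (U : Submodule ℝ E) {σ : ℝ} (hσ : |σ| = 1) :
    CircleDerivBounds (fun w : U => σ * g w) r M := by
  intro u v hu hv huv
  obtain ⟨q₁, q₂, q₃, h1, h2, h3, b1, b2, b3⟩ := h u v hu hv huv
  refine ⟨fun t => σ * q₁ t, fun t => σ * q₂ t, fun t => σ * q₃ t, fun t => (h1 t).const_mul σ,
    fun t => (h2 t).const_mul σ, fun t => (h3 t).const_mul σ, ?_, ?_, ?_⟩ <;> intro t <;>
    rw [abs_mul, hσ, one_mul]
  exacts [b1 t, b2 t, b3 t]

/-- The radial part of y contributes at most 2rM by Euler's identity, the tangential part rM by the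
circle bound. -/
lemma CircleDerivBounds.abs_fderiv_le_of_norm_eq_one {g : E → ℝ} {r : ℕ} {M : ℝ}
    (h : CircleDerivBounds g r M) (hg : ContDiff ℝ 3 g)
    (hhom : ∀ (t : ℝ) u, g (t • u) = t ^ r * g u) (hM : 0 ≤ M) {x : E} (hx : ‖x‖ = 1)
    (hgx : |g x| ≤ 2 * M) (y : E) : |fderiv ℝ g x y| ≤ 3 * r * M * ‖y‖ := by
  set a := inner ℝ x y with ha
  set z := y - a • x with hz
  have hxz : inner ℝ x z = 0 := by
    rw [hz, inner_sub_right, inner_smul_right, real_inner_self_eq_norm_sq, hx, ha]; ring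
  have hay : |a| ≤ ‖y‖ := by simpa [hx] using abs_real_inner_le_norm x y
  have hzy : ‖z‖ ≤ ‖y‖ := by
    refine le_of_sq_le_sq ?_ (norm_nonneg _)
    have h1 : ‖y‖ ^ 2 = a ^ 2 + ‖z‖ ^ 2 := by
      have : y = a • x + z := by rw [hz]; abel
      rw [this, norm_add_sq_real, inner_smul_left, hxz, norm_smul, hx]
      simp
    nlinarith [sq_nonneg a]
  have hy : fderiv ℝ g x y = a * (r * g x) + fderiv ℝ g x z := by
    rw [← fderiv_self_of_homogeneous hg hhom, ← smul_eq_mul, ← map_smul, ← map_add, hz]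
    congr 1
    abel
  have hzb : |fderiv ℝ g x z| ≤ r * M * ‖z‖ := by
    rcases eq_or_ne z 0 with h0 | h0
    · simp [h0]
    · have hn : ‖z‖ ≠ 0 := norm_ne_zero_iff.2 h0
      obtain ⟨q₁, q₂, q₃, h1, -, -, b1, -, -⟩ := h x (‖z‖⁻¹ • z) hx
        (by rw [norm_smul, norm_inv, norm_norm, inv_mul_cancel₀ hn])
        (by rw [inner_smul_right, hxz, mul_zero])
      have b := b1 0
      rw [deriv_circ_one_zero hg h1, map_smul, smul_eq_mul, abs_mul, abs_inv, abs_norm,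
        inv_mul_le_iff₀ (norm_pos_iff.2 h0)] at b
      linarith
  rw [hy]
  calc |a * (r * g x) + fderiv ℝ g x z| ≤ |a| * (r * |g x|) + |fderiv ℝ g x z| := by
        refine (abs_add_le _ _).trans ?_
        rw [abs_mul, abs_mul, Nat.abs_cast]
    _ ≤ ‖y‖ * (r * (2 * M)) + r * M * ‖y‖ := by
        gcongr
        exact hzb.trans (by gcongr)
    _ = _ := by ring

lemma fderiv_smul_of_homogeneous {g : E → ℝ} {r : ℕ} (hg : ContDiff ℝ 3 g)
    (hhom : ∀ (t : ℝ) u, g (t • u) = t ^ r * g u) (t : ℝ) (x y : E) :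
    t * fderiv ℝ g (t • x) y = t ^ r * fderiv ℝ g x y := by
  have hd := hg.differentiable (by norm_num)
  have h1 : HasFDerivAt (fun x => g (t • x)) ((fderiv ℝ g (t • x)).comp
      (t • ContinuousLinearMap.id ℝ E)) x :=
    (hd (t • x)).hasFDerivAt.comp x ((hasFDerivAt_id x).const_smul t)
  have h2 : HasFDerivAt (fun x => t ^ r * g x) (t ^ r • fderiv ℝ g x) x :=
    (hd x).hasFDerivAt.const_mul _
  simp only [hhom] at h1
  simpa using congrArg (fun L => L y) (h1.unique h2)

/-- Homogeneity of degree r - 1 of the derivative extends the bound into the unit ball, where π_V u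
lies. -/
lemma CircleDerivBounds.abs_fderiv_le {g : E → ℝ} {r : ℕ} {M : ℝ}
    (h : CircleDerivBounds g r M) (hg : ContDiff ℝ 3 g) (hr : r ≠ 0)
    (hhom : ∀ (t : ℝ) u, g (t • u) = t ^ r * g u) (hM : 0 ≤ M)
    (hgM : ∀ x, ‖x‖ = 1 → |g x| ≤ 2 * M) {x : E} (hx : x ≠ 0) (hx1 : ‖x‖ ≤ 1) (y : E) :
    |fderiv ℝ g x y| ≤ 3 * r * M * ‖y‖ := by
  have hn : 0 < ‖x‖ := norm_pos_iff.2 hx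
  have hu : ‖‖x‖⁻¹ • x‖ = 1 := by
    rw [norm_smul, norm_inv, norm_norm, inv_mul_cancel₀ hn.ne']
  have h1 := h.abs_fderiv_le_of_norm_eq_one hg hhom hM hu (hgM _ hu) y
  have h2 := fderiv_smul_of_homogeneous hg hhom ‖x‖ (‖x‖⁻¹ • x) y
  rw [smul_inv_smul₀ hn.ne'] at h2
  have h3 : ‖x‖ * |fderiv ℝ g x y| ≤ ‖x‖ * |fderiv ℝ g (‖x‖⁻¹ • x) y| := by
    have h4 := congrArg abs h2
    rw [abs_mul, abs_mul, abs_norm, abs_pow, abs_norm] at h4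
    rw [h4]
    exact mul_le_mul_of_nonneg_right (pow_le_of_le_one hn.le hx1 hr) (abs_nonneg _)
  exact (le_of_mul_le_mul_left h3 hn).trans h1

end CircleBounds

/-! ### The noise component of a returned vector. -/

section Projection

variable {n : ℕ} {F : Measure (EuclideanSpace ℝ (Fin n))}

lemma circleDerivBounds_excess [IsProbabilityMeasure F] {m : ℕ}
    (hF : MemLp id (m : ENNReal) F) {r : ℕ} (hr : r ≤ m) (hr0 : 0 < r) {M : ℝ}
    (hM : ∀ v, ‖v‖ = 1 → |dirMoment F r v| ≤ M) : CircleDerivBounds (excess F r) r M := by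
  intro u v hu hv huv
  obtain ⟨q₁, i1, h1, b1⟩ := (isTrigPoly_dirMoment hF hr u v).exists_hasDerivAt hr0
    fun t => hM _ (norm_circ hu hv huv t)
  obtain ⟨q₂, i2, h2, b2⟩ := i1.exists_hasDerivAt hr0 b1
  obtain ⟨q₃, -, h3, b3⟩ := i2.exists_hasDerivAt hr0 b2
  refine ⟨q₁, q₂, q₃, fun t => ?_, h2, h3, b1, fun t => (b2 t).trans_eq (by ring),
    fun t => (b3 t).trans_eq (by ring)⟩
  have he : (fun t => excess F r (circ u v t)) =
      fun t => dirMoment F r (Real.cos t • u + Real.sin t • v) - gaussMoment r := by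
    funext t
    rw [excess, norm_circ hu hv huv, one_pow, mul_one, circ]
  rw [he]
  exact (h1 t).sub_const _

lemma mem_perp_iff {B : List (EuclideanSpace ℝ (Fin n))} {z : EuclideanSpace ℝ (Fin n)} :
    z ∈ perp B ↔ ∀ x ∈ B, inner ℝ x z = 0 := by
  refine ⟨fun h x hx => h x (Submodule.subset_span hx), fun h => ?_⟩
  rw [Submodule.mem_orthogonal]
  intro x hx
  induction hx using Submodule.span_induction with
  | mem x hx => exact h x hx
  | zero => exact inner_zero_left _
  | add x y _ _ hx hy => rw [inner_add_left, hx, hy, add_zero]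
  | smul c x _ hx => rw [inner_smul_left, hx, mul_zero]

/-- The component of `y` orthogonal to the finite orthonormal family `S`. -/
noncomputable def orthResidual (S : Finset (EuclideanSpace ℝ (Fin n)))
    (y : EuclideanSpace ℝ (Fin n)) : EuclideanSpace ℝ (Fin n) :=
  y - ∑ x ∈ S, inner ℝ x y • x

lemma inner_orthResidual_of_mem {S : Finset (EuclideanSpace ℝ (Fin n))} (h1 : ∀ x ∈ S, ‖x‖ = 1)
    (h2 : ∀ x ∈ S, ∀ y ∈ S, x ≠ y → inner ℝ x y = 0) (y : EuclideanSpace ℝ (Fin n))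
    {x : EuclideanSpace ℝ (Fin n)} (hx : x ∈ S) : inner ℝ x (orthResidual S y) = 0 := by
  rw [orthResidual, inner_sub_right, inner_sum, Finset.sum_eq_single x]
  · rw [inner_smul_right, real_inner_self_eq_norm_sq, h1 x hx]; ring
  · intro b hb hbx
    rw [inner_smul_right, h2 x hx b hb hbx.symm, mul_zero]
  · exact fun h => absurd hx h

lemma inner_orthResidual_of_orthogonal {S : Finset (EuclideanSpace ℝ (Fin n))}
    (y : EuclideanSpace ℝ (Fin n)) {u : EuclideanSpace ℝ (Fin n)}
    (hu : ∀ x ∈ S, inner ℝ x u = 0) : inner ℝ u (orthResidual S y) = inner ℝ u y := by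
  rw [orthResidual, inner_sub_right, inner_sum, Finset.sum_eq_zero, sub_zero]
  intro x hx
  rw [inner_smul_right, real_inner_comm x u, hu x hx, mul_zero]

lemma norm_orthResidual_le {S : Finset (EuclideanSpace ℝ (Fin n))} (h1 : ∀ x ∈ S, ‖x‖ = 1)
    (h2 : ∀ x ∈ S, ∀ y ∈ S, x ≠ y → inner ℝ x y = 0) (y : EuclideanSpace ℝ (Fin n)) :
    ‖orthResidual S y‖ ≤ ‖y‖ := by
  have h3 := inner_orthResidual_of_orthogonal (S := S) y (u := orthResidual S y)
    fun x hx => inner_orthResidual_of_mem h1 h2 y hx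
  rw [real_inner_self_eq_norm_sq] at h3
  have h4 := real_inner_le_norm (orthResidual S y) y
  rw [← h3, sq] at h4
  rcases (norm_nonneg (orthResidual S y)).eq_or_lt with h | h
  · rw [← h]; exact norm_nonneg _
  · exact le_of_mul_le_mul_left h4 h

/-- Since π_V π_W u = 0, only the correction terms contribute, and their coefficients are ⟨x, π_W u⟩
= ⟨π_W x, π_W u⟩. -/
lemma norm_starProjection_orthResidual_le {S : Finset (EuclideanSpace ℝ (Fin n))}
    (h1 : ∀ x ∈ S, ‖x‖ = 1) (V : Submodule ℝ (EuclideanSpace ℝ (Fin n))) {s : ℝ}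
    (hs : ∀ x ∈ S, ‖Vᗮ.starProjection x‖ ≤ s) (u : EuclideanSpace ℝ (Fin n)) :
    ‖V.starProjection (orthResidual S (Vᗮ.starProjection u))‖ ≤
      S.card * (s * ‖Vᗮ.starProjection u‖) := by
  have hPQ : V.starProjection (Vᗮ.starProjection u) = 0 := by
    rw [Submodule.starProjection_apply_eq_zero_iff]
    exact Submodule.starProjection_apply_mem _ _
  rw [orthResidual, map_sub, hPQ, zero_sub, norm_neg, map_sum, ← nsmul_eq_mul]
  refine (norm_sum_le _ _).trans (Finset.sum_le_card_nsmul _ _ _ ?_)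
  intro x hx
  have hi : inner ℝ x (Vᗮ.starProjection u) =
      inner ℝ (Vᗮ.starProjection x) (Vᗮ.starProjection u) := by
    rw [Submodule.inner_starProjection_left_eq_right, Submodule.starProjection_eq_self_iff.2
      (Submodule.starProjection_apply_mem _ _)]
  rw [map_smul, norm_smul, hi]
  have h3 : ‖V.starProjection x‖ ≤ 1 := by
    rw [← h1 x hx]; exact V.norm_starProjection_apply_le x
  have h4 : ‖inner ℝ (Vᗮ.starProjection x) (Vᗮ.starProjection u)‖ ≤ s * ‖Vᗮ.starProjection u‖ :=
    (abs_real_inner_le_norm _ _).trans (mul_le_mul_of_nonneg_right (hs x hx) (norm_nonneg _))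
  calc _ ≤ s * ‖Vᗮ.starProjection u‖ * 1 :=
        mul_le_mul h4 h3 (norm_nonneg _) ((norm_nonneg _).trans h4)
    _ = _ := mul_one _

/-- The vector π_W u may leave B^⊥, where neither the factorisation through V nor the search
applies; its residual z stays inside and is almost in W. -/
lemma norm_starProjection_orthogonal_bound [IsProbabilityMeasure F] {m : ℕ}
    (hF : MemLp id (m : ENNReal) F) {V : Submodule ℝ (EuclideanSpace ℝ (Fin n))}
    (hV : FactorsWithGaussianNoise F V) {r : ℕ} (hr : r ≤ m) (hr0 : r ≠ 0) {M : ℝ} (hM0 : 0 ≤ M)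
    (hM : ∀ v, ‖v‖ = 1 → |dirMoment F r v| ≤ M) (hγ : gaussMoment r ≤ M)
    {B : List (EuclideanSpace ℝ (Fin n))} (h1 : ∀ x ∈ B, ‖x‖ = 1)
    (h2 : ∀ x ∈ B, ∀ y ∈ B, x ≠ y → inner ℝ x y = 0) {s : ℝ} (hs0 : 0 ≤ s)
    (hs : ∀ x ∈ B, ‖Vᗮ.starProjection x‖ ≤ s)
    (hB : ∀ l < r, ∀ u ∈ perp B, excess F l u = 0) {σ : ℝ} (hσ : |σ| = 1) {u : perp B}
    (hu : ‖u‖ = 1) {ε η : ℝ} (hε : 0 < ε) (hε1 : ε ≤ 1 / 100) (hη : 0 < η)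
    (hgu : η ≤ σ * excess F r u)
    (hgrad : ¬ GradientCond ε (fun w : perp B => σ * excess F r w) u) :
    (‖Vᗮ.starProjection (u : EuclideanSpace ℝ (Fin n))‖ - 1.44 * √ε) * η ≤
      3 * M * (B.length * s) := by
  classical
  set p := ‖Vᗮ.starProjection (u : EuclideanSpace ℝ (Fin n))‖ with hp
  have hgsmooth : ContDiff ℝ 3 (fun w : perp B => σ * excess F r w) :=
    contDiff_const.mul ((contDiff_excess hF hr).comp (perp B).subtypeL.contDiff)
  have hhom : ∀ (t : ℝ) (w : perp B), σ * excess F r (t • w : perp B) =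
      t ^ r * (σ * excess F r w) := by
    intro t w
    rw [Submodule.coe_smul, excess_smul]
    ring
  have h1' : ∀ x ∈ B.toFinset, ‖x‖ = 1 := fun x hx => h1 x (List.mem_toFinset.1 hx)
  have h2' : ∀ x ∈ B.toFinset, ∀ y ∈ B.toFinset, x ≠ y → inner ℝ x y = 0 := fun x hx y hy =>
    h2 x (List.mem_toFinset.1 hx) y (List.mem_toFinset.1 hy)
  have hz : orthResidual B.toFinset (Vᗮ.starProjection u) ∈ perp B := mem_perp_iff.2 fun x hx =>
    inner_orthResidual_of_mem h1' h2' _ (List.mem_toFinset.2 hx)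
  set z : perp B := ⟨_, hz⟩ with hzdef
  have hzn : ‖z‖ ≤ p := norm_orthResidual_le h1' h2' _
  have hPz : ‖V.starProjection (z : EuclideanSpace ℝ (Fin n))‖ ≤ B.length * s * p := by
    refine (norm_starProjection_orthResidual_le h1' V
      (fun x hx => hs x (List.mem_toFinset.1 hx)) u).trans ?_
    rw [← mul_assoc]
    gcongr
    exact List.toFinset_card_le B
  have huz : inner ℝ u z = p ^ 2 := by
    rw [Submodule.coe_inner]
    change inner ℝ (u : EuclideanSpace ℝ (Fin n)) (orthResidual _ _) = _
    rw [inner_orthResidual_of_orthogonal _ fun x hx =>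
      mem_perp_iff.1 u.2 x (List.mem_toFinset.1 hx),
      ← Submodule.starProjection_eq_self_iff.2
      (Submodule.starProjection_apply_mem Vᗮ (u : EuclideanSpace ℝ (Fin n))),
      ← Submodule.inner_starProjection_left_eq_right, real_inner_self_eq_norm_sq]
  have hproj : ∀ w : perp B, excess F r w = excess F r (V.starProjection w) := fun w =>
    excess_eq_excess_starProjection hF hV hr hB w.2
  have hgpos : 0 < σ * excess F r u := hη.trans_le hgu
  have hfd : fderiv ℝ (fun w : perp B => σ * excess F r w) u z =
      σ * fderiv ℝ (excess F r) (V.starProjection u) (V.starProjection z) := by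
    have hd := (((contDiff_excess hF hr).differentiable (by norm_num)
      (V.starProjection u)).hasFDerivAt.comp u
      ((V.starProjection.comp (perp B).subtypeL).hasFDerivAt (x := u))).const_mul σ
    simp only [hproj]
    have := hd.fderiv
    simp only [Function.comp_def] at this
    exact congrArg (fun L => L z) this
  have hne : V.starProjection (u : EuclideanSpace ℝ (Fin n)) ≠ 0 := by
    intro h0
    rw [hproj, h0] at hgpos
    have := excess_smul (F := F) r 0 0
    rw [zero_pow hr0, zero_mul, zero_smul] at this
    rw [this, mul_zero] at hgpos
    exact lt_irrefl _ hgpos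
  have hbound := (circleDerivBounds_excess hF hr (Nat.pos_of_ne_zero hr0) hM).abs_fderiv_le
    (contDiff_excess hF hr) hr0 (excess_smul r) hM0 (fun x hx => by
      rw [excess, hx, one_pow, mul_one]
      refine (abs_sub _ _).trans ?_
      rw [abs_of_nonneg (gaussMoment_nonneg r)]
      linarith [hM x hx]) hne
    ((V.norm_starProjection_apply_le _).trans_eq hu) (V.starProjection z)
  have hmain := (abs_le.1 (abs_fderiv_sub_le hgsmooth hhom hu hgpos.le hε hε1 hgrad z)).1
  have habs : fderiv ℝ (fun w : perp B => σ * excess F r w) u z ≤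
      3 * r * M * (B.length * s * p) := by
    rw [hfd]
    refine (le_abs_self _).trans ?_
    rw [abs_mul, hσ, one_mul]
    exact hbound.trans (by gcongr)
  rw [huz] at hmain
  have hrpos : (0 : ℝ) < r := by exact_mod_cast Nat.pos_of_ne_zero hr0
  have hrhs : 0 ≤ 3 * M * (B.length * s) := by positivity
  have hp0 : 0 ≤ p := norm_nonneg _
  -- In the second case p > 0, so both bounds on the derivative can be divided by rp.
  rcases le_or_gt p (1.44 * √ε) with hle | hlt
  · exact (mul_nonpos_of_nonpos_of_nonneg (by linarith) hη.le).trans hrhs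
  · have hppos : 0 < p := lt_of_le_of_lt (by positivity) hlt
    have e1 : 1.44 * √ε * (r * (σ * excess F r u)) * ‖z‖ ≤
        1.44 * √ε * (r * (σ * excess F r u)) * p := by gcongr
    have e2 : (r * p) * ((p - 1.44 * √ε) * (σ * excess F r u)) ≤
        (r * p) * (3 * M * (B.length * s)) := by linarith
    have e3 := le_of_mul_le_mul_left e2 (by positivity)
    refine le_trans ?_ e3
    have : 0 ≤ p - 1.44 * √ε := by linarith
    gcongr

end Projection

/-! ### Unit norm of the iterates. -/

section Norm

variable {E : Type*} [NormedAddCommGroup E] [InnerProductSpace ℝ E]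

lemma norm_renormalize_add {u x : E} (hu : ‖u‖ = 1) (hx : inner ℝ u x = 0) :
    ‖renormalize (u + x)‖ = 1 := by
  have h : u + x ≠ 0 := by
    intro h
    have h1 : inner ℝ u (u + x) = 1 := by
      rw [inner_add_right, hx, real_inner_self_eq_norm_sq, hu]; norm_num
    rw [h, inner_zero_right] at h1
    exact zero_ne_one h1
  rw [renormalize, norm_smul, norm_inv, norm_norm, inv_mul_cancel₀ (norm_ne_zero_iff.2 h)]

/-- No step size bounds enter, so this also covers V = ⊤, where the ascent argument is not run. -/
lemma LocalOptReturns.norm_eq_one [CompleteSpace E] {g : E → ℝ} {r : ℕ} {ε r₁ r₂ : ℝ} {u₀ u : E}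
    (hu : ‖u₀‖ = 1) (h : LocalOptReturns ε r₁ r₂ r g u₀ u) : ‖u‖ = 1 := by
  obtain ⟨hrun, -, -⟩ := h
  induction hrun with
  | refl => exact hu
  | tail _ hstep ih =>
    cases hstep with
    | first h =>
      exact norm_renormalize_add ih (by rw [inner_smul_right, inner_self_tangentGradient ih, mul_zero])
    | second v h hv h2 =>
      rw [sub_eq_add_neg]
      exact norm_renormalize_add ih (by rw [inner_neg_right, inner_smul_right, hv.orth]; simp)

end Norm

/-! ### Error recursion and conclusion. -/

section Main

variable {n : ℕ} {F : Measure (EuclideanSpace ℝ (Fin n))}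

lemma excess_apply_zero [IsProbabilityMeasure F] (r : ℕ) : excess F r 0 = 0 := by
  rcases eq_or_ne r 0 with rfl | hr
  · simp [excess, dirMoment, gaussMoment_zero]
  · simp [excess, dirMoment, hr]

/-- On a unit vector of W the moment f_r equals γ_r. -/
lemma gaussMoment_le_of_ne_top [IsProbabilityMeasure F] {m : ℕ} (hF : MemLp id (m : ENNReal) F)
    {V : Submodule ℝ (EuclideanSpace ℝ (Fin n))} (hV : FactorsWithGaussianNoise F V)
    (hVtop : V ≠ ⊤) {r : ℕ} (hr : r ≤ m) {M : ℝ} (hM : ∀ v, ‖v‖ = 1 → |dirMoment F r v| ≤ M) :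
    gaussMoment r ≤ M := by
  obtain ⟨w, hw, hw0⟩ := Submodule.exists_mem_ne_zero_of_ne_bot
    (fun h => hVtop ((Submodule.orthogonal_eq_bot_iff).1 h) : Vᗮ ≠ ⊥)
  have hn : ‖w‖ ≠ 0 := norm_ne_zero_iff.2 hw0
  have hu : ‖‖w‖⁻¹ • w‖ = 1 := by rw [norm_smul, norm_inv, norm_norm, inv_mul_cancel₀ hn]
  have h0 : V.starProjection (‖w‖⁻¹ • w) = 0 := by
    rw [Submodule.starProjection_apply_eq_zero_iff]
    exact Submodule.smul_mem _ _ hw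
  have h1 : excess F r (‖w‖⁻¹ • w) = 0 := by
    rw [excess_split hF hV hr, h0]
    simp [excess_apply_zero]
  rw [excess, hu, one_pow, mul_one, sub_eq_zero] at h1
  rw [← h1]
  exact (le_abs_self _).trans (hM _ hu)

lemma excess_eq_zero_of_sphere [IsProbabilityMeasure F] {r : ℕ}
    {U : Submodule ℝ (EuclideanSpace ℝ (Fin n))}
    (h : ∀ v ∈ U, ‖v‖ = 1 → dirMoment F r v = gaussMoment r) {u : EuclideanSpace ℝ (Fin n)}
    (hu : u ∈ U) : excess F r u = 0 := by
  rcases eq_or_ne u 0 with rfl | h0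
  · exact excess_apply_zero r
  · have hn : ‖u‖ ≠ 0 := norm_ne_zero_iff.2 h0
    have h1 : ‖‖u‖⁻¹ • u‖ = 1 := by rw [norm_smul, norm_inv, norm_norm, inv_mul_cancel₀ hn]
    have h2 := excess_smul (F := F) r ‖u‖ (‖u‖⁻¹ • u)
    have h3 : excess F r (‖u‖⁻¹ • u) = 0 := by
      rw [excess, h (‖u‖⁻¹ • u) (U.smul_mem _ hu) h1, h1]; ring
    rwa [smul_inv_smul₀ hn, h3, mul_zero] at h2

lemma excess_two (hI : IsIsotropic F) (u : EuclideanSpace ℝ (Fin n)) : excess F 2 u = 0 := by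
  rw [excess, hI.cov, gaussMoment_two]; ring

/-- By isotropy g_2 = 0, so the gradient test reads 0 ≤ 0 and always succeeds: the search never
halts, and vectors are found only at orders r ≥ 3. -/
lemma not_localOptReturns_two (hI : IsIsotropic F) {U : Submodule ℝ (EuclideanSpace ℝ (Fin n))}
    {σ ε r₁ r₂ : ℝ} {v u : U} :
    ¬ LocalOptReturns ε r₁ r₂ 2 (fun w : U => σ * excess F 2 w) v u := by
  intro h
  refine h.halt₁ ?_
  simp [GradientCond, excess_two hI, gradient_fun_const]

/-- Here d is the new error, d^8 the old bound on ‖π_W x‖, and the factor d on the left comes from η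
≥ M d. Dividing costs one power, and smallness of (k+1)d absorbs the constants. -/
lemma sq_le_of_error_bound {p e d k : ℝ} (hp : 0 ≤ p) (hk : 0 ≤ k) (hd : 0 < d)
    (hdk : (k + 1) * d ≤ 1 / 10) (he : e ≤ d ^ 8)
    (h : (p - 1.44 * e) * d ≤ 3 * (k * d ^ 8)) : p ^ 2 ≤ d := by
  have hd1 : d ≤ 1 / 10 := by nlinarith
  have h1 : p ≤ 1.44 * e + 3 * (k * d ^ 7) := by
    refine le_of_mul_le_mul_right ?_ hd
    nlinarith
  have h2 : d ^ 6 ≤ d := by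
    calc d ^ 6 ≤ d ^ 1 := pow_le_pow_of_le_one hd.le (by linarith) (by norm_num)
      _ = d := pow_one d
  have h3 : 1.44 * d ^ 8 + 3 * (k * d ^ 7) ≤ d ^ 6 := by
    have : 1.44 * d ^ 2 + 3 * (k * d) ≤ 1 := by nlinarith
    calc 1.44 * d ^ 8 + 3 * (k * d ^ 7) = d ^ 6 * (1.44 * d ^ 2 + 3 * (k * d)) := by ring
      _ ≤ d ^ 6 * 1 := by gcongr
      _ = d ^ 6 := mul_one _
  have h4 : p ≤ d := by linarith
  nlinarith

lemma rpow_sixteenth_le {ε : ℝ} (hε : 0 < ε) (hε1 : ε ≤ 1) {i j : ℕ} (hij : i ≤ j) :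
    ε ^ (((1 : ℝ) / 16) ^ i) ≤ ε ^ (((1 : ℝ) / 16) ^ j) :=
  Real.rpow_le_rpow_of_exponent_ge hε hε1
    (pow_le_pow_of_le_one (by norm_num) (by norm_num) hij)

lemma rpow_sixteenth_eq_pow {ε : ℝ} (hε : 0 < ε) (j : ℕ) :
    ε ^ (((1 : ℝ) / 16) ^ j) = (ε ^ (((1 : ℝ) / 16) ^ (j + 1))) ^ 16 := by
  rw [← Real.rpow_natCast (ε ^ _), ← Real.rpow_mul hε.le, pow_succ]
  congr 1
  push_cast
  ring

/-- After any execution, the vectors found are orthonormal and close to `V`, and the moments below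
the current order are Gaussian on their orthogonal complement. -/
theorem FindBasisRun.orthonormal_and_close [IsProbabilityMeasure F] {m k : ℕ}
    (hF : MemLp id (m : ENNReal) F) (hI : IsIsotropic F)
    {V : Submodule ℝ (EuclideanSpace ℝ (Fin n))} (hV : FactorsWithGaussianNoise F V)
    {ε : ℝ} (hε : 0 < ε) (hε1 : ε ≤ 1 / 100) (hεk : (k + 1) * ε ^ (((1 : ℝ) / 16) ^ k) ≤ 1 / 10)
    {M η r₁ r₂ : ℕ → ℝ}
    (hM : ∀ i ∈ Finset.Icc 3 m, ∀ v : EuclideanSpace ℝ (Fin n), ‖v‖ = 1 → |dirMoment F i v| ≤ M i)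
    (hadm : ∀ i ∈ Finset.Icc 3 m, AdmissibleSteps i ε (M i) (η i) (r₁ i) (r₂ i))
    {B : List (EuclideanSpace ℝ (Fin n))} {r : ℕ} (hrun : FindBasisRun F m ε η r₁ r₂ B r)
    (hBk : B.length ≤ k)
    (hη : ∀ i ∈ Finset.Icc 3 m, M i * ε ^ (((1 : ℝ) / 16) ^ B.length) ≤ η i) :
    2 ≤ r ∧ (∀ l < r, ∀ u ∈ perp B, excess F l u = 0) ∧ (∀ x ∈ B, ‖x‖ = 1) ∧
      (∀ x ∈ B, ∀ y ∈ B, x ≠ y → inner ℝ x y = 0) ∧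
      ∀ x ∈ B, ‖Vᗮ.starProjection x‖ ^ 2 ≤ ε ^ (((1 : ℝ) / 16) ^ B.length) := by
  induction hrun with
  | start =>
    refine ⟨le_rfl, fun l hl u _ => ?_, by simp, by simp, by simp⟩
    interval_cases l
    · simp [excess, dirMoment, gaussMoment_zero]
    · rw [excess, hI.mean, gaussMoment_one]; ring
  | raise B r _ _ _ hgauss ih =>
    obtain ⟨h1, h2, h3, h4, h5⟩ := ih hBk hη
    refine ⟨by omega, fun l hl u hu => ?_, h3, h4, h5⟩
    rcases Nat.lt_succ_iff_lt_or_eq.1 hl with hl | rfl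
    · exact h2 l hl u hu
    · exact excess_eq_zero_of_sphere hgauss hu
  | find B r _ _ hrm σ hσ v u hv hstart hopt ih =>
    rw [List.length_append, List.length_singleton] at hBk hη ⊢
    have hle : ε ^ (((1 : ℝ) / 16) ^ B.length) ≤ ε ^ (((1 : ℝ) / 16) ^ (B.length + 1)) :=
      rpow_sixteenth_le hε (by linarith) (Nat.le_succ _)
    -- A shorter list demands a weaker lower bound on η, so the hypothesis descends to B.
    obtain ⟨h1, h2, h3, h4, h5⟩ := ih (by omega) fun i hi =>
      (mul_le_mul_of_nonneg_left hle (hadm i hi).M_pos.le).trans (hη i hi)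
    have hr3 : 3 ≤ r := by
      rcases h1.eq_or_lt with rfl | h
      · exact absurd hopt (not_localOptReturns_two hI)
      · exact h
    have hri : r ∈ Finset.Icc 3 m := Finset.mem_Icc.2 ⟨hr3, hrm⟩
    have hMpos := (hadm r hri).M_pos
    have hηpos := (hadm r hri).η_pos
    have hσ1 : |σ| = 1 := by rcases hσ with rfl | rfl <;> simp
    have hσle (a : ℝ) : σ * a ≤ |a| := by
      calc σ * a ≤ |σ * a| := le_abs_self _
        _ = |a| := by rw [abs_mul, hσ1, one_mul]
    have hu1 : ‖u‖ = 1 := hopt.norm_eq_one hv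
    have huQ : ‖Vᗮ.starProjection (u : EuclideanSpace ℝ (Fin n))‖ ^ 2 ≤
        ε ^ (((1 : ℝ) / 16) ^ (B.length + 1)) := by
      -- If V = ⊤ there is no noise direction to give γ_r ≤ M, but then π_W u = 0.
      by_cases hVtop : V = ⊤
      · have : Vᗮ.starProjection (u : EuclideanSpace ℝ (Fin n)) = 0 := by
          rw [Submodule.starProjection_apply_eq_zero_iff, hVtop]
          simp
        rw [this, norm_zero, zero_pow two_ne_zero]
        positivity
      have hMr := hM r hri
      have hγ := gaussMoment_le_of_ne_top hF hV hVtop hrm hMr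
      have hηM : η r ≤ 2 * M r := by
        refine hstart.trans ((hσle _).trans ?_)
        rw [excess, show ‖(v : EuclideanSpace ℝ (Fin n))‖ = 1 from hv, one_pow, mul_one]
        refine (abs_sub _ _).trans ?_
        rw [abs_of_nonneg (gaussMoment_nonneg r)]
        linarith [hMr v hv]
      have hgu := (LocalOptReturns.norm_eq_and_le (g := fun w : perp B => σ * excess F r w) hr3
        (contDiff_const.mul ((contDiff_excess hF hrm).comp (perp B).subtypeL.contDiff))
        (fun t w => by simp only [Submodule.coe_smul, excess_smul]; ring)
        ((circleDerivBounds_excess hF hrm (by omega) hMr).restrict (perp B) hσ1)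
        (hadm r hri) hηM hε hε1 hv hstart hopt).2
      set d := ε ^ (((1 : ℝ) / 16) ^ (B.length + 1)) with hd
      have hd0 : 0 < d := Real.rpow_pos_of_pos hε _
      have hpow : ε ^ (((1 : ℝ) / 16) ^ B.length) = (d ^ 8) ^ 2 := by
        rw [rpow_sixteenth_eq_pow hε, ← hd]; ring
      have hbound := norm_starProjection_orthogonal_bound hF hV hrm (by omega) hMpos.le hMr hγ h3 h4
        (s := d ^ 8) (by positivity) (fun x hx => by
          have := h5 x hx
          rw [hpow] at this
          exact le_of_sq_le_sq this (by positivity)) h2 hσ1 hu1 hε hε1 hηpos hgu hopt.halt₁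
      have hdk : d ≤ ε ^ (((1 : ℝ) / 16) ^ k) := rpow_sixteenth_le hε (by linarith) hBk
      -- Squared, this is ε ≤ ε^((1/16)^|B|), monotonicity of the exponent down to |B| = 0.
      have he : √ε ≤ d ^ 8 := by
        rw [Real.sqrt_le_left (by positivity), ← hpow]
        simpa using rpow_sixteenth_le hε (by linarith) (Nat.zero_le B.length)
      set p := ‖Vᗮ.starProjection (u : EuclideanSpace ℝ (Fin n))‖
      have hBk' : (B.length : ℝ) ≤ k := by exact_mod_cast (by omega : B.length ≤ k)
      refine sq_le_of_error_bound (k := k) (norm_nonneg _) (by positivity) hd0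
        (le_trans (by gcongr) hεk) he ?_
      -- Replacing η by its lower bound M d requires a positive factor.
      rcases le_or_gt (p - 1.44 * √ε) 0 with hneg | hpos
      · exact (mul_nonpos_of_nonpos_of_nonneg hneg hd0.le).trans (by positivity)
      · refine le_of_mul_le_mul_left ?_ hMpos
        calc M r * ((p - 1.44 * √ε) * d) = (p - 1.44 * √ε) * (M r * d) := by ring
          _ ≤ (p - 1.44 * √ε) * η r := by gcongr; exact hη r hri
          _ ≤ 3 * M r * (B.length * d ^ 8) := hbound
          _ ≤ 3 * M r * (k * d ^ 8) := by gcongr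
          _ = M r * (3 * (k * d ^ 8)) := by ring
    refine ⟨h1, fun l hl w hw => h2 l hl w (mem_perp_iff.2 fun x hx =>
      mem_perp_iff.1 hw x (List.mem_append_left _ hx)), ?_, ?_, ?_⟩
    · intro x hx
      rcases List.mem_append.1 hx with hx | hx
      · exact h3 x hx
      · rw [List.mem_singleton.1 hx]; exact hu1
    · intro x hx y hy hxy
      rcases List.mem_append.1 hx with hx | hx <;> rcases List.mem_append.1 hy with hy | hy
      · exact h4 x hx y hy hxy
      · rw [List.mem_singleton.1 hy]; exact mem_perp_iff.1 u.2 x hx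
      · rw [List.mem_singleton.1 hx, real_inner_comm]; exact mem_perp_iff.1 u.2 y hy
      · exact absurd ((List.mem_singleton.1 hx).trans (List.mem_singleton.1 hy).symm) hxy
    · intro x hx
      rcases List.mem_append.1 hx with hx | hx
      · exact (h5 x hx).trans hle
      · rw [List.mem_singleton.1 hx]; exact huQ

end Main

theorem mainTheorem7 (k : ℕ) :
    ∃ ε₀ : ℝ, 0 < ε₀ ∧
      ∀ (n m : ℕ) (F : Measure (EuclideanSpace ℝ (Fin n)))
        (V : Submodule ℝ (EuclideanSpace ℝ (Fin n)))
        (ε₁ : ℝ) (M η r₁ r₂ : ℕ → ℝ)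
        (us : List (EuclideanSpace ℝ (Fin n))) (u : EuclideanSpace ℝ (Fin n)) (j r : ℕ),
        IsProbabilityMeasure F →
        MemLp id (m : ENNReal) F →
        IsIsotropic F →
        Module.finrank ℝ V = k →
        FactorsWithGaussianNoise F V →
        0 < ε₁ → ε₁ ≤ ε₀ →
        (∀ i ∈ Finset.Icc 3 m, ∀ v : EuclideanSpace ℝ (Fin n), ‖v‖ = 1 →
          |dirMoment F i v| ≤ M i) →
        (∀ i ∈ Finset.Icc 3 m, AdmissibleSteps i ε₁ (M i) (η i) (r₁ i) (r₂ i)) →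
        (∀ i ∈ Finset.Icc 3 m, M i * ε₁ ^ (((1 : ℝ) / 16) ^ j) ≤ η i) →
        us.length + 1 = j → j ≤ k →
        FindBasisRun F m ε₁ η r₁ r₂ (us ++ [u]) r →
        1 - ε₁ ^ (((1 : ℝ) / 16) ^ j) ≤ ‖V.starProjection u‖ ^ 2 ∧
          1 - ε₁ ^ (((1 : ℝ) / 16) ^ k) ≤ ‖V.starProjection u‖ ^ 2 := by
  have hbase : (0 : ℝ) < 1 / (10 * (k + 1)) := by positivity
  -- The power 16^k undoes the exponent (1/16)^k, giving (k+1) ε₁^((1/16)^k) ≤ 1/10.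
  refine ⟨min (1 / 100) ((1 / (10 * (k + 1))) ^ 16 ^ k), by positivity, ?_⟩
  intro n m F V ε₁ M η r₁ r₂ us u j r hprob hF hI _ hV hε hε0 hM hadm hη hj hjk hrun
  have hε1 : ε₁ ≤ 1 / 100 := hε0.trans (min_le_left _ _)
  have hεk : (k + 1) * ε₁ ^ (((1 : ℝ) / 16) ^ k) ≤ 1 / 10 := by
    have h1 : ε₁ ^ (((1 : ℝ) / 16) ^ k) ≤ 1 / (10 * (k + 1)) := by
      refine (Real.rpow_le_rpow hε.le (hε0.trans (min_le_right _ _)) (by positivity)).trans_eq ?_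
      rw [← Real.rpow_natCast, ← Real.rpow_mul hbase.le]
      push_cast
      rw [← mul_pow]
      norm_num
    calc (k + 1) * ε₁ ^ (((1 : ℝ) / 16) ^ k) ≤ (k + 1) * (1 / (10 * (k + 1))) := by gcongr
      _ = 1 / 10 := by field_simp
  have hlen : (us ++ [u]).length = j := by simpa using hj
  obtain ⟨-, -, h3, -, h5⟩ := hrun.orthonormal_and_close hF hI hV hε hε1 hεk hM hadm
    (by rwa [hlen]) (by rwa [hlen])
  have hu := h3 u (by simp)
  have huQ := h5 u (by simp)
  rw [hlen] at huQ
  have hsplit := Submodule.norm_sq_eq_add_norm_sq_starProjection u V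
  rw [hu] at hsplit
  have hjk' := rpow_sixteenth_le hε (by linarith) hjk
  exact ⟨by linarith, by linarith⟩
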